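/- Let $L=\{\unlhd,\wedge,R\}$, with $\unlhd,R$ binary relation symbols and $\wedge$ a binary function symbol, and let $\mathbb K$ be the class of finite $L$-structures $A$ such that $(A,\unlhd,\wedge)$ is a meet-tree (a partial order in which the elements below any given element are pairwise comparable and $x\wedge y$ is the greatest lower bound of $x,y$) and $R$ is a graph (a symmetric irreflexive relation) on $A$. Then $\mathbb K$ has a countable Fraïssé limit (the generic meet-tree with a random graph), and its complete theory $T$ satisfies: (1) $T$ is NTP$_2$: there are no formula $\varphi(x;y)$ ($x,y$ finite tuples of variables), array $(a_{i,j})_{i,j<\omega}$ of tuples in a model of $T$ and $k<\omega$ such that $\{\varphi(x;a_{i,f(i)}):i<\omega\}$ is consistent for every $f:\omega\to\omega$ and $\{\varphi(x;a_{i,j}):j<\omega\}$ is $k$-inconsistent for every $i$. (2) $T$ is inp-minimal: there are no formulas $\varphi_0(x;y_0),\varphi_1(x;y_1)$ with $x$ a single variable, tuples $(a_{i,j})_{i<2,j<\omega}$ in a model of $T$ and $k_0,k_1<\omega$ such that $\{\varphi_i(x;a_{i,j}):j<\omega\}$ is $k_i$-inconsistent for $i=0,1$ and $\{\varphi_0(x;a_{0,f(0)}),\varphi_1(x;a_{1,f(1)})\}$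 is consistent for every $f:\{0,1\}\to\omega$. (3) $\kappa_{\mathrm{shred}}(T)=\infty$. Consequently not every complete NTP$_2$ theory is unshreddable. Here, working in a monster model $\mathbb M$ of a complete theory $T$: a formula $\varphi(x;a)$ $\lambda$-shreds over a set $A$, witnessed by $\bar b=\langle b_\alpha:\alpha<\lambda\rangle$, if $\bar b$ is indiscernible over $A$ and for no $\alpha<\lambda$ and $c\in\varphi(\mathbb M;a)$ is $\langle b_\beta:\alpha\le\beta<\lambda\rangle$ indiscernible over $Ac$. A type over $B\supseteq A$ shreds over $A$ with a built-in witness if it implies a formula that $(|T|+|A|)^+$-shreds over $A$, witnessed by a sequence contained in $B$. For $m<\omega$, $\kappa^m_{\mathrm{shred}}(T)$ is the least regular cardinal $\kappa$ for which there are no increasing continuous sequence of models $\langle M_i:i\le\kappa\rangle$ and $p\in S^m(M_\kappa)$ such that $p\restriction M_{i+1}$ shreds over $M_i$ with a built-in witness for all $i<\kappa$, and $\infty$ if there is no such $\kappa$; $\kappa_{\mathrm{shred}}(T)=\sup_m\kappa^m_{\mathrm{shred}}(T)$, and $T$ is unshreddable if $\kappa_{\mathrm{shred}}(T)<\infty$.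 -/

import Mathlib

open FirstOrder Language Cardinal Set

universe u

noncomputable section

namespace ShredNTP

section ModelTheory

variable {L : FirstOrder.Language.{0, 0}}

/-! ### Formulas with parameters, consistency

A formula over (a subset of) a model `M` in the variables `x_0, …, x_{n-1}` is an element of
`L.Formula (M ⊕ Fin n)`: the variables in `M` are read as the corresponding elements.
A monster model is replaced throughout by "all elementary extensions of `M`": whatever a monster
model containing `M` realizes over `M` is realized in some elementary extension of `M` living in
the same universe, and conversely. -/

/-- A set of formulas over `M` is consistent if some tuple in some elementary extension of `M`
realizes it. -/
def Consistent {M : Type u} [L.Structure M] {n : ℕ} (Γ : Set (L.Formula (M ⊕ Fin n))) : Prop :=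
  ∃ (N : Type u) (_ : L.Structure N) (f : M ↪ₑ[L] N) (c : Fin n → N),
    ∀ ψ ∈ Γ, ψ.Realize (Sum.elim f c)

/-- A set of formulas over `M` implies a formula over `M`. -/
def Implies {M : Type u} [L.Structure M] {n : ℕ} (Γ : Set (L.Formula (M ⊕ Fin n)))
    (φ : L.Formula (M ⊕ Fin n)) : Prop :=
  ∀ (N : Type u) [L.Structure N] (f : M ↪ₑ[L] N) (c : Fin n → N),
    (∀ ψ ∈ Γ, ψ.Realize (Sum.elim f c)) → φ.Realize (Sum.elim f c)

/-- The formula `φ(x; a)` over `M` obtained from `φ(x; y)` by substituting `a` for `y`. -/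
def inst {M : Type u} {n l : ℕ} (φ : L.Formula (Fin n ⊕ Fin l)) (a : Fin l → M) :
    L.Formula (M ⊕ Fin n) :=
  φ.relabel (Sum.elim Sum.inr (fun j => Sum.inl (a j)))

/-- The family `φ(x; a_j)`, `j < ω`, is `k`-inconsistent. -/
def KInconsistent {M : Type u} [L.Structure M] {n l : ℕ} (φ : L.Formula (Fin n ⊕ Fin l))
    (a : ℕ → Fin l → M) (k : ℕ) : Prop :=
  ∀ s : Finset ℕ, s.card = k → ¬ Consistent {ψ | ∃ j ∈ s, ψ = inst φ (a j)}

/-! ### `TP₂` and inp-patterns -/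

/-- `φ(x; y)` has the tree property of the second kind modulo `T`. -/
def HasTP2 (T : L.Theory) {n l : ℕ} (φ : L.Formula (Fin n ⊕ Fin l)) : Prop :=
  ∃ (M : Theory.ModelType.{0, 0, u} T) (a : ℕ → ℕ → Fin l → M) (k : ℕ),
    (∀ f : ℕ → ℕ, Consistent {ψ | ∃ i, ψ = inst φ (a i (f i))}) ∧
    ∀ i, KInconsistent φ (a i) k

/-- `T` is `NTP₂`: no formula has `TP₂` modulo `T`. -/
def IsNTP2 (T : L.Theory) : Prop :=
  ∀ (n l : ℕ) (φ : L.Formula (Fin n ⊕ Fin l)), ¬ HasTP2.{u} T φ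

/-- There is an inp-pattern modulo `T` in `n` variables whose rows are indexed by `ι`: for every
row `i` a formula `φ_i(x; y_i)`, parameters `(a_{i,j})_{j<ω}` and a number `k_i` such that every row
is `k_i`-inconsistent and every path is consistent. -/
def HasInpPattern (T : L.Theory) (n : ℕ) (ι : Type) : Prop :=
  ∃ (M : Theory.ModelType.{0, 0, u} T) (l : ι → ℕ) (φ : ∀ i, L.Formula (Fin n ⊕ Fin (l i)))
    (a : ∀ i, ℕ → Fin (l i) → M) (k : ι → ℕ),
    (∀ f : ι → ℕ, Consistent {ψ | ∃ i, ψ = inst (φ i) (a i (f i))}) ∧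
    ∀ i, KInconsistent (φ i) (a i) (k i)

/-- `T` is inp-minimal: there is no inp-pattern of depth two in a single variable. -/
def IsInpMinimal (T : L.Theory) : Prop :=
  ¬ HasInpPattern.{u} T 1 (Fin 2)

/-! ### Shredding -/

/-- The sequence `b` of `k`-tuples of `M` is indiscernible over the set `A`. -/
def IsIndiscernible {M : Type u} [L.Structure M] {I : Type u} [LinearOrder I] {k : ℕ}
    (A : Set M) (b : I → Fin k → M) : Prop :=
  ∀ (n : ℕ) (φ : L.Formula (A ⊕ (Fin n × Fin k))) (s t : Fin n → I),
    StrictMono s → StrictMono t →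
    (φ.Realize (Sum.elim Subtype.val (fun q => b (s q.1) q.2)) ↔
      φ.Realize (Sum.elim Subtype.val (fun q => b (t q.1) q.2)))

/-- The sequence `b` of length `lam` witnesses that the formula `φ` over `M` `lam`-shreds over `A`:
it is indiscernible over `A`, and for no `α < lam` and no realization `c` of `φ` (in any elementary
extension of `M`) is the end segment `b_{≥ α}` indiscernible over `A ∪ c`. -/
def ShredsWith {M : Type u} [L.Structure M] {m k : ℕ} (lam : Cardinal.{u}) (A : Set M)
    (φ : L.Formula (M ⊕ Fin m)) (b : lam.ord.ToType → Fin k → M) : Prop :=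
  IsIndiscernible (L := L) A b ∧
  ∀ (N : Type u) [L.Structure N] (f : M ↪ₑ[L] N) (c : Fin m → N),
    φ.Realize (Sum.elim f c) → ∀ α : lam.ord.ToType,
      ¬ IsIndiscernible (L := L) (f '' A ∪ range c)
          (fun (β : Set.Ici α) (j : Fin k) => f (b β j))

/-- The set of formulas over `M` (with parameters as variables) that belong to the complete type
`p ∈ S^m(M)`. -/
def typeFormulas {M : Type u} [L.Structure M] {m : ℕ}
    (p : (L.elementaryDiagram M).CompleteType (Fin m)) : Set (L.Formula (M ⊕ Fin m)) :=
  {ψ | Formula.equivSentence (BoundedFormula.constantsVarsEquiv.symm ψ) ∈ p}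

/-- The restriction to `B ⊆ M` of a set of formulas over `M`: those of its formulas all of whose
parameters lie in `B`. -/
def restrictTo {M : Type u} {m : ℕ} (Γ : Set (L.Formula (M ⊕ Fin m))) (B : Set M) :
    Set (L.Formula (M ⊕ Fin m)) :=
  {ψ ∈ Γ | ∃ χ : L.Formula (B ⊕ Fin m), ψ = Formula.relabel (Sum.map Subtype.val id) χ}

/-- The cardinal `(|T| + |A|)⁺`, where `|T| = |L| + ℵ₀`. -/
def shredLength (L : FirstOrder.Language.{0, 0}) {M : Type u} (A : Set M) : Cardinal.{u} :=
  Order.succ (Cardinal.lift.{u} L.card + ℵ₀ + #A)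

/-- The type `p ↾ B`, for `p ∈ S^m(M)`, shreds over `A ⊆ B` with a built-in witness: it implies a
formula which `(|T| + |A|)⁺`-shreds over `A`, witnessed by an indiscernible sequence in `B`. -/
def RestrictionShreds {M : Type u} [L.Structure M] {m : ℕ}
    (p : (L.elementaryDiagram M).CompleteType (Fin m)) (A B : Set M) : Prop :=
  A ⊆ B ∧
  ∃ φ : L.Formula (M ⊕ Fin m), Implies (restrictTo (typeFormulas p) B) φ ∧
    ∃ (k : ℕ) (b : (shredLength L A).ord.ToType → Fin k → M),
      (∀ α j, b α j ∈ B) ∧ ShredsWith (shredLength L A) A φ b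

/-- There are an increasing continuous chain `⟨M_i : i ≤ κ⟩` of models of `T` (elementary
substructures of the last one, `M = M_κ`) and a type `p ∈ S^m(M_κ)` such that for every `i < κ` the
type `p ↾ M_{i+1}` shreds over `M_i` with a built-in witness. -/
def HasShredChain (T : L.Theory) (m : ℕ) (κ : Cardinal.{u}) : Prop :=
  ∃ (M : Theory.ModelType.{0, 0, u} T) (S : Ordinal.{u} → L.ElementarySubstructure M)
    (p : (L.elementaryDiagram M).CompleteType (Fin m)),
    (∀ i j, i ≤ j → j ≤ κ.ord → (S i : Set M) ⊆ S j) ∧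
    (∀ δ, δ ≤ κ.ord → Order.IsSuccLimit δ → (S δ : Set M) = ⋃ i ∈ Set.Iio δ, (S i : Set M)) ∧
    (S κ.ord : Set M) = Set.univ ∧
    ∀ i, i < κ.ord → RestrictionShreds p (S i : Set M) (S (Order.succ i) : Set M)

/-- `κ^m_shred(T)`: the least regular cardinal `κ` without a chain as above, and `⊤` (that is, `∞`)
if there is none. -/
def kappaShredIn (T : L.Theory) (m : ℕ) : WithTop Cardinal.{u} :=
  sInf ((fun κ : Cardinal.{u} => (κ : WithTop Cardinal.{u})) ''
    {κ | κ.IsRegular ∧ ¬ HasShredChain T m κ})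

/-- `κ_shred(T) = sup_m κ^m_shred(T)`. -/
def kappaShred (T : L.Theory) : WithTop Cardinal.{u} :=
  ⨆ m : ℕ, kappaShredIn T m

/-- `T` is unshreddable. -/
def IsUnshreddable (T : L.Theory) : Prop :=
  kappaShred.{u} T < ⊤

end ModelTheory

/-! ### Meet-trees with a graph -/

/-- The function symbols: a binary symbol for the meet. -/
inductive TreeGraphFunctions : ℕ → Type
  | meet : TreeGraphFunctions 2

/-- The relation symbols: binary symbols for the tree order and for the graph. -/
inductive TreeGraphRelations : ℕ → Type
  | le : TreeGraphRelations 2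
  | adj : TreeGraphRelations 2

/-- The language `{⊴, ∧, R}`. -/
def treeGraph : FirstOrder.Language.{0, 0} where
  Functions := TreeGraphFunctions
  Relations := TreeGraphRelations

instance : Countable (Σ l, treeGraph.Functions l) := by
  have : Subsingleton (Σ l, TreeGraphFunctions l) := by
    constructor
    rintro ⟨_, ⟨⟩⟩ ⟨_, ⟨⟩⟩
    rfl
  exact (inferInstance : Countable (Σ l, TreeGraphFunctions l))

section

variable {A : Type u} [treeGraph.Structure A]

/-- The interpretation of `⊴`. -/
def tle (x y : A) : Prop :=
  Structure.RelMap (L := treeGraph) (M := A) (n := 2) TreeGraphRelations.le ![x, y]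

/-- The interpretation of `∧`. -/
def tmeet (x y : A) : A :=
  Structure.funMap (L := treeGraph) (M := A) (n := 2) TreeGraphFunctions.meet ![x, y]

/-- The interpretation of `R`. -/
def tadj (x y : A) : Prop :=
  Structure.RelMap (L := treeGraph) (M := A) (n := 2) TreeGraphRelations.adj ![x, y]

end

/-- `(A, ⊴, ∧)` is a meet-tree, i.e. a partial order in which the elements below any given element
are pairwise comparable and in which `x ∧ y` is the greatest lower bound of `x` and `y`, and
`(A, R)` is a graph. -/
structure IsMeetTreeWithGraph (A : Type u) [treeGraph.Structure A] : Prop where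
  le_refl : ∀ x : A, tle x x
  le_antisymm : ∀ x y : A, tle x y → tle y x → x = y
  le_trans : ∀ x y z : A, tle x y → tle y z → tle x z
  comparable_below : ∀ x y z : A, tle x z → tle y z → tle x y ∨ tle y x
  meet_le_left : ∀ x y : A, tle (tmeet x y) x
  meet_le_right : ∀ x y : A, tle (tmeet x y) y
  le_meet : ∀ x y z : A, tle z x → tle z y → tle z (tmeet x y)
  adj_symm : ∀ x y : A, tadj x y → tadj y x
  adj_irrefl : ∀ x : A, ¬ tadj x x

/-- The class of finite meet-trees with a graph. -/
def finiteTreeGraphs : Set (CategoryTheory.Bundled.{0} treeGraph.Structure) :=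
  {A | Finite A ∧ IsMeetTreeWithGraph A}

end ShredNTP

end

noncomputable section

namespace ShredNTP

/-! ### The generic meet-tree with a random graph -/

/-! The limit is built concretely on the natural numbers: each new element is a leaf over, or sits
just below, an earlier one, with prescribed adjacency to a finite set. A finite extension of
meet-trees splits into such one-point steps, so finite partial isomorphisms extend
(`PartialIso.exists_extend`). This gives the age and ultrahomogeneity. In a tree the binary meets of
a family are closed under meets, so the type of a finite tuple is determined by the order and the
graph on binary meets (`Gen.exists_equiv_of_forall_iff`).

NTP₂ and inp-minimality both follow from the absence of inp-patterns in `n` variables with more than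
`n ^ 2` rows (`not_hasInpPattern`). By Ramsey's theorem the rows may be taken finite, long and
mutually indiscernible for the order and the graph, and a first-order sentence moves the situation
into `Gen`. Let `c` realize the middle column of every row. In a tree, one element cannot disturb
two mutually indiscernible rows (`MutuallyIndiscernible.isUniform_or`): the segments and cones
through it are nested, and a nested pair stays nested when the columns of one row are changed. The
tuple `c` has at most `n ^ 2` binary meets, so by pigeonhole some row is tree-indiscernible over
`c`. The graph is free: keeping the tree position of `c`, the graph can be redefined so that many
columns at once relate to a copy of `c` as the middle column does
(`exists_simultaneous_conjugates`). This contradicts the inconsistency of the row.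

Shredding uses the interaction of the meet with the graph. A comb has a stem `E`, a fork `G > E`,
and teeth `b` above `G`, some adjacent to `E` and some not. Over elements that are not above `E`,
the stem is not a meet of the available elements, so the teeth are indiscernible
(`IsComb.realize_iff`). If however `x ∧ G = E`, then `x ∧ b = E` for every tooth, so `R(x ∧ b, b)`
reads off the adjacency; with both kinds of teeth cofinal, no end segment is indiscernible over `x`.
Combs are stacked along any ordinal so that each later stem meets the fork of every earlier comb in
its stem. The type of a stem above all levels then shreds at every step (`hasShredChain`). The stack
is realized in an ultrapower of `Gen` over valuations of names for its elements, and the models are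
the classes of functions with finite support among the names of lower levels. Their size is bounded
by beth numbers, and each level is given enough teeth to exceed the model below it. -/

/-- An instruction: insert a new leaf above (`false`) or a new element just below (`true`) a given
element, adjacent to a given finite set. -/
abbrev Task := Bool × ℕ × Finset ℕ

/-- An enumeration of all instructions, each of which occurs infinitely often. -/
def task (k : ℕ) : Task := ((Encodable.decode (α := Task) k.unpair.1).getD (false, 0, ∅))

theorem exists_task_eq (t : Task) (n : ℕ) : ∃ k, n ≤ k ∧ task k = t :=
  ⟨Nat.pair (Encodable.encode t) n, Nat.right_le_pair _ _, by simp [task]⟩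

/-- The element at which the `k`-th element is inserted. -/
def anchor (k : ℕ) : ℕ := if (task k).2.1 < k then (task k).2.1 else 0

/-- The fallback value `0` covers instructions that mention an element not yet inserted; the strict
bound makes the recursion for `genLe` terminate. -/
theorem anchor_lt {k : ℕ} (hk : 0 < k) : anchor k < k := by
  unfold anchor
  split_ifs with h
  exacts [h, hk]

/-- Whether the `k`-th element is inserted below its anchor. -/
def isBelow (k : ℕ) : Prop := (task k).1 = true

/-- The tree order of the generic structure. -/
def genLe (m n : ℕ) : Prop :=
  if m = n then True
  -- The later element decides. It lies above what its anchor lies above, the anchor itself being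
  -- excluded if it was inserted beneath it. It lies below an earlier element only if it was
  -- inserted beneath its anchor and the anchor lies below that element.
  else if m < n then genLe m (anchor n) ∧ (isBelow n → m ≠ anchor n)
  else isBelow m ∧ genLe (anchor m) n
termination_by m + n
decreasing_by
  · have := anchor_lt (k := n) (by omega)
    omega
  · have := anchor_lt (k := m) (by omega)
    omega

theorem genLe_refl (m : ℕ) : genLe m m := by
  rw [genLe]; simp

theorem genLe_of_lt {m n : ℕ} (h : m < n) :
    genLe m n ↔ genLe m (anchor n) ∧ (isBelow n → m ≠ anchor n) := by
  rw [genLe, if_neg h.ne, if_pos h]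

theorem genLe_of_gt {m n : ℕ} (h : n < m) :
    genLe m n ↔ isBelow m ∧ genLe (anchor m) n := by
  rw [genLe, if_neg h.ne', if_neg (by omega)]

/-- The axioms are proved together because the induction step for a new element uses several of them
at its anchor. The bound `g ≤ max x y` on numerical indices says that a meet is never created later
than both of its arguments, so initial segments are closed under meets. -/
theorem genLe_axioms (N : ℕ) :
    (∀ x < N, ∀ y < N, genLe x y → genLe y x → x = y) ∧
    (∀ x < N, ∀ y < N, ∀ z < N, genLe x y → genLe y z → genLe x z) ∧
    (∀ x < N, ∀ y < N, ∀ z < N, genLe x z → genLe y z → genLe x y ∨ genLe y x) ∧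
    (∀ x < N, ∀ y < N, ∃ g ≤ max x y, genLe g x ∧ genLe g y ∧
      ∀ z < N, genLe z x → genLe z y → genLe z g) := by
  induction N with
  | zero => simp
  | succ N ih =>
    obtain ⟨ha, ht, hc, hm⟩ := ih
    rcases Nat.eq_zero_or_pos N with rfl | hN
    · refine ⟨by omega, ?_, ?_, ?_⟩
      · intro x hx y hy z hz
        obtain rfl : x = 0 := by omega
        obtain rfl : z = 0 := by omega
        intros; exact genLe_refl _
      · intro x hx y hy z hz
        obtain rfl : x = 0 := by omega
        obtain rfl : y = 0 := by omega
        intros; exact .inl (genLe_refl _)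
      · intro x hx y hy
        obtain rfl : x = 0 := by omega
        obtain rfl : y = 0 := by omega
        refine ⟨0, by simp, genLe_refl _, genLe_refl _, fun z hz h _ => h⟩
    have hb := anchor_lt hN
    set b := anchor N
    have hr := genLe_refl
    have h1 : ∀ z < N, (genLe z N ↔ genLe z b ∧ (isBelow N → z ≠ b)) := fun z hz => genLe_of_lt hz
    have h2 : ∀ z < N, (genLe N z ↔ isBelow N ∧ genLe b z) := fun z hz => genLe_of_gt hz
    have hlt : ∀ x, x < N + 1 ↔ x < N ∨ x = N := fun x => by omega
    simp only [hlt]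
    generalize isBelow N = p at *
    refine ⟨?_, ?_, ?_, ?_⟩
    · rintro x (hx | rfl) y (hy | rfl) hxy hyx
      · exact ha x hx y hy hxy hyx
      · grind
      · grind
      · rfl
    · rintro x (hx | rfl) y (hy | rfl) z (hz | rfl) hxy hyz
      · exact ht x hx y hy z hz hxy hyz
      all_goals grind
    · rintro x (hx | rfl) y (hy | rfl) z (hz | rfl) hxz hyz
      · exact hc x hx y hy z hz hxz hyz
      all_goals grind
    -- The meet of the new element with `y` is the new element if it lies below `y`, and otherwise
    -- the meet of its anchor with `y`.
    · have key : ∀ y < N, ∃ g ≤ N, genLe g N ∧ genLe g y ∧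
          ∀ z, (z < N ∨ z = N) → genLe z N → genLe z y → genLe z g := by
        intro y hy
        by_cases hby : genLe b y ∧ p
        · exact ⟨N, le_rfl, hr N, (h2 y hy).2 ⟨hby.2, hby.1⟩, fun z _ h _ => h⟩
        · obtain ⟨g, hg, hgb, hgy, hglb⟩ := hm b hb y hy
          have hg' : g < N := by omega
          refine ⟨g, hg'.le, ?_, hgy, ?_⟩
          · grind
          · rintro z (hz | rfl) hzN hzy <;> grind
      rintro x (hx | rfl) y (hy | rfl)
      · obtain ⟨g, hg, hgx, hgy, hglb⟩ := hm x hx y hy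
        have hg' : g < N := by omega
        refine ⟨g, hg, hgx, hgy, ?_⟩
        rintro z (hz | rfl) hzx hzy
        · exact hglb z hz hzx hzy
        · grind
      · obtain ⟨g, hg, h3, h4, h5⟩ := key x hx
        exact ⟨g, by omega, h4, h3, fun z hz h h' => h5 z hz h' h⟩
      · obtain ⟨g, hg, h3, h4, h5⟩ := key y hy
        exact ⟨g, by omega, h3, h4, h5⟩
      · exact ⟨_, le_max_left _ _, hr _, hr _, fun z _ h _ => h⟩

/-- The meet found in the initial segment of `x` and `y` remains the meet later on: a meet computed
in a larger segment has index at most `max x y`, so it was already available for comparison. -/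
theorem exists_genLe_glb (x y : ℕ) :
    ∃ g ≤ max x y, genLe g x ∧ genLe g y ∧ ∀ z, genLe z x → genLe z y → genLe z g := by
  obtain ⟨g, hg, hx, hy, h⟩ := (genLe_axioms (max x y + 1)).2.2.2 x (by omega) y (by omega)
  refine ⟨g, hg, hx, hy, fun z hzx hzy => ?_⟩
  obtain ⟨-, htr, -, hm⟩ := genLe_axioms (max (max x y) z + 1)
  obtain ⟨g', hg', hx', hy', h'⟩ := hm x (by omega) y (by omega)
  exact htr z (by omega) g' (by omega) g (by omega) (h' z (by omega) hzx hzy)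
    (h g' (by omega) hx' hy')

theorem genLe_antisymm {x y : ℕ} : genLe x y → genLe y x → x = y :=
  (genLe_axioms (max x y + 1 : ℕ)).1 x (by omega) y (by omega)

theorem genLe_trans {x y z : ℕ} : genLe x y → genLe y z → genLe x z :=
  (genLe_axioms (max (max x y : ℕ) z + 1)).2.1 x (by omega) y (by omega) z (by omega)

theorem genLe_total_of_genLe {x y z : ℕ} : genLe x z → genLe y z → genLe x y ∨ genLe y x :=
  (genLe_axioms (max (max x y : ℕ) z + 1)).2.2.1 x (by omega) y (by omega) z (by omega)

/-- The underlying set of the generic meet-tree with a random graph. -/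
def Gen : Type := ℕ

namespace Gen

instance : Countable Gen := inferInstanceAs (Countable ℕ)

instance : Inhabited Gen := inferInstanceAs (Inhabited ℕ)

instance : DecidableEq Gen := inferInstanceAs (DecidableEq ℕ)

instance : SemilatticeInf Gen where
  le := genLe
  le_refl := genLe_refl
  le_trans _ _ _ := genLe_trans
  le_antisymm _ _ := genLe_antisymm
  inf x y := (exists_genLe_glb x y).choose
  inf_le_left x y := (exists_genLe_glb x y).choose_spec.2.1
  inf_le_right x y := (exists_genLe_glb x y).choose_spec.2.2.1
  le_inf z x y := (exists_genLe_glb x y).choose_spec.2.2.2 z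

/-- The graph of the generic structure. -/
def adj (x y : Gen) : Prop :=
  (show ℕ from x) ∈ (task y).2.2 ∧ Nat.lt x y ∨ (show ℕ from y) ∈ (task x).2.2 ∧ Nat.lt y x

theorem adj_symm {x y : Gen} (h : adj x y) : adj y x := Or.symm h

theorem adj_irrefl (x : Gen) : ¬ adj x x := by
  rintro (h | h) <;> exact Nat.lt_irrefl _ h.2

theorem le_total_of_le {x y z : Gen} : x ≤ z → y ≤ z → x ≤ y ∨ y ≤ x :=
  genLe_total_of_genLe

/-- There is a leaf above a given element with a prescribed graph relation to a finite set. -/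
theorem exists_leaf (A : Finset Gen) (d : Gen) (U : Set Gen) :
    ∃ x, x ∉ A ∧ d < x ∧ ∀ z ∈ A, (z ≤ x ↔ z ≤ d) ∧ ¬ x ≤ z ∧ x ⊓ z ≤ d ∧
      (adj x z ↔ z ∈ U) := by
  classical
  -- The instruction is taken at a stage after all elements of `A` and `d`, so that its anchor
  -- really is `d`.
  obtain ⟨k, hk, ht⟩ := exists_task_eq (false, (d : ℕ), A.filter (· ∈ U))
    ((insert d A).sup (fun z : Gen => (show ℕ from z)) + 1)
  have hA : ∀ z ∈ insert d A, (show ℕ from z) < k := fun z hz =>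
    lt_of_lt_of_le (Nat.lt_succ_of_le (Finset.le_sup (f := fun z : Gen => (show ℕ from z)) hz)) hk
  have ha : anchor k = (d : ℕ) := by
    have := hA d (Finset.mem_insert_self _ _)
    rw [anchor, ht]; exact if_pos this
  have hb : ¬ isBelow k := by rw [isBelow, ht]; simp
  have hle : ∀ z ∈ insert d A, (z ≤ (show Gen from k) ↔ z ≤ d) ∧ ¬ (show Gen from k) ≤ z := by
    intro z hz
    refine ⟨(genLe_of_lt (hA z hz)).trans ?_, fun h => ?_⟩
    · rw [ha]; simp only [hb, false_implies, and_true]; rfl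
    · exact hb ((genLe_of_gt (hA z hz)).1 h).1
  refine ⟨(show Gen from k), fun h => ?_, ?_, fun z hz => ?_⟩
  · exact Nat.lt_irrefl _ (hA _ (Finset.mem_insert_of_mem h))
  · have := hle d (Finset.mem_insert_self _ _)
    exact lt_of_le_not_ge (this.1.2 le_rfl) this.2
  · have hz' := Finset.mem_insert_of_mem (b := d) hz
    have := hA z hz'
    refine ⟨(hle z hz').1, (hle z hz').2, ?_, ?_⟩
    · set x : Gen := k
      -- The meet has index at most that of `x` and is not `x`, so it is an earlier element below
      -- the leaf `x`, hence below the anchor `d`.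
      have h1 : Nat.le (x ⊓ z : Gen) (max k (z : ℕ)) := (exists_genLe_glb k z).choose_spec.1
      rw [max_eq_left (Nat.le_of_lt this)] at h1
      rcases Nat.eq_or_lt_of_le h1 with h1 | h1
      · exact absurd (inf_eq_left (α := Gen) (a := x) |>.1 h1) (hle z hz').2
      · have h2 := (genLe_of_lt h1).1 (inf_le_left (a := x) (b := z))
        rw [ha] at h2
        exact h2.1
    constructor
    · rintro (h | h)
      · exact absurd h.2 (Nat.lt_asymm this)
      · have := h.1; rw [ht] at this; exact (Finset.mem_filter.1 this).2
    · intro h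
      refine .inr ⟨?_, this⟩
      rw [ht]; exact Finset.mem_filter.2 ⟨hz, h⟩

/-- There is an element just below a given element with a prescribed graph relation to a finite
set. -/
theorem exists_below (A : Finset Gen) (u : Gen) (U : Set Gen) :
    ∃ x, x ∉ A ∧ x < u ∧ ∀ z ∈ A, (z ≤ x ↔ z < u) ∧ (x ≤ z ↔ u ≤ z) ∧ (adj x z ↔ z ∈ U) := by
  classical
  obtain ⟨k, hk, ht⟩ := exists_task_eq (true, (u : ℕ), A.filter (· ∈ U))
    ((insert u A).sup (fun z : Gen => (show ℕ from z)) + 1)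
  have hA : ∀ z ∈ insert u A, (show ℕ from z) < k := fun z hz =>
    lt_of_lt_of_le (Nat.lt_succ_of_le (Finset.le_sup (f := fun z : Gen => (show ℕ from z)) hz)) hk
  have ha : anchor k = (u : ℕ) := by
    have := hA u (Finset.mem_insert_self _ _)
    rw [anchor, ht]; exact if_pos this
  have hb : isBelow k := by rw [isBelow, ht]
  have hle : ∀ z ∈ insert u A, (z ≤ (show Gen from k) ↔ z < u) ∧
      ((show Gen from k) ≤ z ↔ u ≤ z) := by
    intro z hz
    refine ⟨(genLe_of_lt (hA z hz)).trans ?_, (genLe_of_gt (hA z hz)).trans ?_⟩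
    · rw [ha, lt_iff_le_and_ne]; simp only [hb, true_implies]; rfl
    · rw [ha]; simp only [hb, true_and]; rfl
  refine ⟨(show Gen from k), fun h => ?_, ?_, fun z hz => ?_⟩
  · exact Nat.lt_irrefl _ (hA _ (Finset.mem_insert_of_mem h))
  · have := hle u (Finset.mem_insert_self _ _)
    exact lt_of_le_not_ge (this.2.2 le_rfl) (fun h => lt_irrefl _ (this.1.1 h))
  · have hz' := Finset.mem_insert_of_mem (b := u) hz
    refine ⟨(hle z hz').1, (hle z hz').2, ?_⟩
    have := hA z hz'
    constructor
    · rintro (h | h)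
      · exact absurd h.2 (Nat.lt_asymm this)
      · have := h.1; rw [ht] at this; exact (Finset.mem_filter.1 this).2
    · intro h
      refine .inr ⟨?_, this⟩
      rw [ht]; exact Finset.mem_filter.2 ⟨hz, h⟩

instance : treeGraph.Structure Gen where
  funMap {n} f v := match n, f, v with
    | _, TreeGraphFunctions.meet, v => v 0 ⊓ v 1
  RelMap {n} r v := match n, r, v with
    | _, TreeGraphRelations.le, v => v 0 ≤ v 1
    | _, TreeGraphRelations.adj, v => adj (v 0) (v 1)

theorem tle_iff {x y : Gen} : tle x y ↔ x ≤ y := Iff.rfl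

theorem tmeet_eq (x y : Gen) : tmeet x y = x ⊓ y := rfl

theorem isMeetTreeWithGraph : IsMeetTreeWithGraph Gen where
  le_refl := le_refl (α := Gen)
  le_antisymm _ _ := le_antisymm (α := Gen)
  le_trans _ _ _ := le_trans (α := Gen)
  comparable_below _ _ _ := le_total_of_le
  meet_le_left _ _ := inf_le_left (α := Gen)
  meet_le_right _ _ := inf_le_right (α := Gen)
  le_meet _ _ _ := le_inf (α := Gen)
  adj_symm _ _ := adj_symm
  adj_irrefl := adj_irrefl

end Gen

/-! ### Finite partial isomorphisms into the generic structure -/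

section PartialIso

variable {X : Type*} [SemilatticeInf X]

/-- The elements below any given element are pairwise comparable. -/
def IsTree (X : Type*) [SemilatticeInf X] : Prop :=
  ∀ ⦃x y z : X⦄, x ≤ z → y ≤ z → x ≤ y ∨ y ≤ x

theorem Gen.isTree : IsTree Gen := fun _ _ _ => Gen.le_total_of_le

/-- `f` is an isomorphism from the finite set `A` with the induced order, meet and the graph `R` to
a subset of the generic structure. -/
structure PartialIso (R : X → X → Prop) (A : Finset X) (f : X → Gen) : Prop where
  le_iff : ∀ x ∈ A, ∀ y ∈ A, (f x ≤ f y ↔ x ≤ y)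
  map_inf : ∀ x ∈ A, ∀ y ∈ A, f (x ⊓ y) = f x ⊓ f y
  adj_iff : ∀ x ∈ A, ∀ y ∈ A, (Gen.adj (f x) (f y) ↔ R x y)

variable {R : X → X → Prop} {A B : Finset X} {f : X → Gen}

theorem PartialIso.lt_iff (hf : PartialIso R A f) {x y : X} (hx : x ∈ A) (hy : y ∈ A) :
    f x < f y ↔ x < y := by
  rw [lt_iff_le_not_ge, lt_iff_le_not_ge, hf.le_iff x hx y hy, hf.le_iff y hy x hx]

theorem PartialIso.congr {g : X → Gen} (hf : PartialIso R A f) (hA : InfClosed (A : Set X))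
    (h : ∀ a ∈ A, g a = f a) : PartialIso R A g where
  le_iff x hx y hy := by rw [h x hx, h y hy, hf.le_iff x hx y hy]
  map_inf x hx y hy := by rw [h x hx, h y hy, h _ (hA hx hy), hf.map_inf x hx y hy]
  adj_iff x hx y hy := by rw [h x hx, h y hy, hf.adj_iff x hx y hy]

theorem PartialIso.cons [DecidableEq X] {x : X} {g : X → Gen} (hf : PartialIso R A g)
    (hs : ∀ x y, R x y → R y x) (hi : ∀ x, ¬ R x x)
    (hle : ∀ z ∈ A, (g x ≤ g z ↔ x ≤ z) ∧ (g z ≤ g x ↔ z ≤ x) ∧ g (x ⊓ z) = g x ⊓ g z ∧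
      (Gen.adj (g x) (g z) ↔ R x z)) : PartialIso R (insert x A) g := by
  have hs' : ∀ x y, R x y ↔ R y x := fun x y => ⟨hs x y, hs y x⟩
  have hadj : ∀ x y, Gen.adj x y ↔ Gen.adj y x := fun x y => ⟨Gen.adj_symm, Gen.adj_symm⟩
  constructor
  all_goals
    intro a ha' b hb'
    rcases Finset.mem_insert.1 ha' with rfl | ha <;> rcases Finset.mem_insert.1 hb' with rfl | hb
  · simp
  · exact (hle b hb).1
  · exact (hle a ha).2.1
  · exact hf.le_iff a ha b hb
  · simp
  · exact (hle b hb).2.2.1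
  · rw [inf_comm, (hle a ha).2.2.1, inf_comm]
  · exact hf.map_inf a ha b hb
  · exact iff_of_false (Gen.adj_irrefl _) (hi _)
  · exact (hle b hb).2.2.2
  · rw [hs', hadj]; exact (hle a ha).2.2.2
  · exact hf.adj_iff a ha b hb

/-- There are two possible positions for `x`. If some element of `A` lies above `x`, there is a
least such element and the image goes just below its image. Otherwise the meets of `x` with `A` lie
in `A` and form a chain, and the image is a leaf over the image of the largest one. The graph on the
new point is free in both cases. -/
theorem PartialIso.exists_extend_one [DecidableEq X] (hX : IsTree X)
    (hs : ∀ x y, R x y → R y x) (hi : ∀ x, ¬ R x x)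
    (hA : InfClosed (A : Set X)) (hf : PartialIso R A f) {x : X} (hxA : x ∉ A)
    (hx : ∀ a ∈ A, x ⊓ a ∈ A ∨ x ⊓ a = x) :
    ∃ g : X → Gen, (∀ a ∈ A, g a = f a) ∧ PartialIso R (insert x A) g := by
  classical
  set U : Set Gen := {w | ∃ z ∈ A, f z = w ∧ R x z} with hU
  have hfinj : ∀ a ∈ A, ∀ b ∈ A, f a = f b → a = b := fun a ha b hb h =>
    le_antisymm ((hf.le_iff a ha b hb).1 h.le) ((hf.le_iff b hb a ha).1 h.ge)
  have hUz : ∀ z ∈ A, (f z ∈ U ↔ R x z) := fun z hz =>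
    ⟨fun ⟨w, hw, h, hr⟩ => hfinj w hw z hz h ▸ hr, fun h => ⟨z, hz, rfl, h⟩⟩
  suffices h : ∃ x' : Gen, ∀ z ∈ A, (x' ≤ f z ↔ x ≤ z) ∧ (f z ≤ x' ↔ z ≤ x) ∧
      (x ⊓ z ∈ A → f (x ⊓ z) = x' ⊓ f z) ∧ (Gen.adj x' (f z) ↔ R x z) by
    obtain ⟨x', hx'⟩ := h
    have hu : ∀ a ∈ A, Function.update f x x' a = f a := fun a ha =>
      Function.update_of_ne (fun h : a = x => hxA (h ▸ ha)) _ _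
    refine ⟨Function.update f x x', hu, (hf.congr hA hu).cons hs hi fun z hz => ?_⟩
    rw [hu z hz, Function.update_self]
    obtain ⟨h1, h2, h3, h4⟩ := hx' z hz
    refine ⟨h1, h2, ?_, h4⟩
    by_cases h : x ⊓ z ∈ A
    · rw [hu _ h, h3 h]
    · have h5 := (hx z hz).resolve_left h
      rw [h5, Function.update_self, eq_comm, inf_eq_left, h1]
      exact inf_eq_left.1 h5
  by_cases hab : ∃ a ∈ A, x ≤ a
  · obtain ⟨a, ha, hxa⟩ := hab
    have hne : (A.filter (x ≤ ·)).Nonempty := ⟨a, Finset.mem_filter.2 ⟨ha, hxa⟩⟩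
    -- The least element of `A` above `x`; it lies in `A` because `A` is closed under meets.
    set u := (A.filter (x ≤ ·)).inf' hne id
    have hu : u ∈ A ∧ x ≤ u := by
      refine ⟨?_, Finset.le_inf' _ _ fun b hb => (Finset.mem_filter.1 hb).2⟩
      exact hA.finsetInf'_mem hne fun b hb => (Finset.mem_filter.1 hb).1
    have hxu : ∀ z ∈ A, (x ≤ z ↔ u ≤ z) := fun z hz =>
      ⟨fun h => Finset.inf'_le (f := id) (Finset.mem_filter.2 ⟨hz, h⟩), hu.2.trans⟩
    have hlt : x < u := lt_of_le_of_ne hu.2 fun h => hxA (h ▸ hu.1)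
    have hux : ∀ z ∈ A, (z ≤ x ↔ z < u) := fun z hz =>
      ⟨fun h => h.trans_lt hlt, fun h => (hX h.le hu.2).resolve_right fun h' =>
        (lt_of_lt_of_le h ((hxu z hz).1 h')).false⟩
    obtain ⟨x', -, hx'u, hx'⟩ := Gen.exists_below (A.image f) (f u) U
    refine ⟨x', fun z hz => ?_⟩
    obtain ⟨h1, h2, h3⟩ := hx' (f z) (Finset.mem_image_of_mem _ hz)
    refine ⟨?_, ?_, fun hmem => ?_, h3.trans (hUz z hz)⟩
    · rw [h2, hf.le_iff u hu.1 z hz, hxu z hz]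
    · rw [h1, hf.lt_iff hz hu.1, hux z hz]
    · have hnz : ¬ u ≤ z := fun h => hxA (by rwa [inf_eq_left.2 ((hxu z hz).2 h)] at hmem)
      have hm := hA hu.1 hz
      have hm1 : u ⊓ z < u := inf_lt_left.2 hnz
      have e : x ⊓ z = u ⊓ z := le_antisymm (inf_le_inf_right _ hu.2)
        (le_inf ((hux _ hm).2 hm1) inf_le_right)
      rw [e, hf.map_inf u hu.1 z hz]
      refine le_antisymm (le_inf ?_ inf_le_right) (inf_le_inf_right _ hx'u.le)
      rw [← hf.map_inf u hu.1 z hz, (hx' _ (Finset.mem_image_of_mem _ hm)).1]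
      exact (hf.lt_iff hm hu.1).2 hm1
  · push Not at hab
    have hmem : ∀ a ∈ A, x ⊓ a ∈ A := fun a ha =>
      (hx a ha).resolve_right fun h => hab a ha (inf_eq_left.1 h)
    rcases A.eq_empty_or_nonempty with rfl | hne
    · exact ⟨default, by simp⟩
    obtain ⟨d, hd⟩ := (A.image (x ⊓ ·)).exists_maximal (hne.image _)
    obtain ⟨a, ha, rfl⟩ := Finset.mem_image.1 hd.1
    set d := x ⊓ a
    have hdx : d ≤ x := inf_le_left
    have hdA : d ∈ A := hmem a ha
    have hmax : ∀ z ∈ A, x ⊓ z ≤ d := fun z hz =>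
      (hX (inf_le_left : x ⊓ z ≤ x) hdx).elim id fun h =>
        hd.2 (Finset.mem_image_of_mem _ hz) h
    obtain ⟨x', -, hx'd, hx'⟩ := Gen.exists_leaf (A.image f) (f d) U
    refine ⟨x', fun z hz => ?_⟩
    obtain ⟨h1, h2, h3, h4⟩ := hx' (f z) (Finset.mem_image_of_mem _ hz)
    refine ⟨iff_of_false h2 (hab z hz), ?_, fun _ => ?_, h4.trans (hUz z hz)⟩
    · rw [h1, hf.le_iff z hz d hdA]
      exact ⟨fun h => h.trans hdx, fun h => (inf_eq_right.2 h).symm.le.trans (hmax z hz)⟩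
    · have e : x ⊓ z = d ⊓ z := le_antisymm (le_inf (hmax z hz) inf_le_right)
        (inf_le_inf_right _ hdx)
      rw [e, hf.map_inf d hdA z hz]
      exact le_antisymm (inf_le_inf_right _ hx'd.le) (le_inf h3 inf_le_right)

/-- Finite partial isomorphisms into the generic structure extend to finite supersets. -/
theorem PartialIso.exists_extend (hX : IsTree X)
    (hs : ∀ x y, R x y → R y x) (hi : ∀ x, ¬ R x x) (hB : InfClosed (B : Set X)) (hAB : A ⊆ B)
    (hA : InfClosed (A : Set X)) (hf : PartialIso R A f) :
    ∃ g : X → Gen, (∀ a ∈ A, g a = f a) ∧ PartialIso R B g := by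
  classical
  induction hn : (B \ A).card generalizing A f with
  | zero =>
    have : A = B := hAB.antisymm (Finset.sdiff_eq_empty_iff_subset.1 (Finset.card_eq_zero.1 hn))
    exact ⟨f, fun _ _ => rfl, this ▸ hf⟩
  | succ n ih =>
    -- Minimality puts every meet of `x` with `A` that differs from `x` into `A`, as the one-point
    -- step requires.
    obtain ⟨x, hx⟩ := (B \ A).exists_minimal (Finset.card_pos.1 (by omega))
    obtain ⟨hxB, hxA⟩ := Finset.mem_sdiff.1 hx.1
    have hx' : ∀ a ∈ A, x ⊓ a ∈ A ∨ x ⊓ a = x := by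
      intro a ha
      by_contra! h
      exact h.2 (le_antisymm inf_le_left
        (hx.2 (Finset.mem_sdiff.2 ⟨hB hxB (hAB ha), h.1⟩) inf_le_left))
    obtain ⟨g, hg, hgA⟩ := hf.exists_extend_one hX hs hi hA hxA hx'
    have hins : InfClosed (insert x A : Finset X) (α := X) := by
      intro a ha b hb
      simp only [Finset.coe_insert, Set.mem_insert_iff, Finset.mem_coe] at *
      rcases ha with rfl | ha <;> rcases hb with rfl | hb
      · simp
      · exact (hx' b hb).symm
      · rw [inf_comm]; exact (hx' a ha).symm
      · exact .inr (hA ha hb)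
    obtain ⟨h, hh, hhB⟩ := ih (Finset.insert_subset hxB hAB) hins hgA (by
      rw [Finset.sdiff_insert, Finset.card_erase_of_mem hx.1, hn]; rfl)
    exact ⟨h, fun a ha => by rw [hh a (Finset.mem_insert_of_mem ha), hg a ha], hhB⟩

end PartialIso

/-! ### Embeddings in the language of meet-trees with a graph -/

section Structures

variable {A : Type*} [treeGraph.Structure A] {B : Type*} [treeGraph.Structure B]

theorem funMap_meet (v : Fin 2 → A) :
    Structure.funMap (L := treeGraph) (M := A) (n := 2) TreeGraphFunctions.meet v =
      tmeet (v 0) (v 1) :=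
  congrArg _ (by ext i; fin_cases i <;> rfl)

theorem relMap_le (v : Fin 2 → A) :
    Structure.RelMap (L := treeGraph) (M := A) (n := 2) TreeGraphRelations.le v ↔
      tle (v 0) (v 1) :=
  iff_of_eq (congrArg _ (by ext i; fin_cases i <;> rfl))

theorem relMap_adj (v : Fin 2 → A) :
    Structure.RelMap (L := treeGraph) (M := A) (n := 2) TreeGraphRelations.adj v ↔
      tadj (v 0) (v 1) :=
  iff_of_eq (congrArg _ (by ext i; fin_cases i <;> rfl))

/-- An injective map respecting order, meet and graph is an embedding. -/
def mkEmbedding (f : A → B) (hf : Function.Injective f)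
    (hm : ∀ x y, f (tmeet x y) = tmeet (f x) (f y)) (hl : ∀ x y, tle (f x) (f y) ↔ tle x y)
    (ha : ∀ x y, tadj (f x) (f y) ↔ tadj x y) : A ↪[treeGraph] B where
  toFun := f
  inj' := hf
  map_fun' {n} g v := by
    match n, g, v with
    | _, TreeGraphFunctions.meet, v => erw [funMap_meet, funMap_meet, hm]; rfl
  map_rel' {n} r v := by
    match n, r, v with
    | _, TreeGraphRelations.le, v => erw [relMap_le, relMap_le, ← hl]; rfl
    | _, TreeGraphRelations.adj, v => erw [relMap_adj, relMap_adj, ← ha]; rfl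

theorem map_tmeet (f : A ↪[treeGraph] B) (x y : A) : f (tmeet x y) = tmeet (f x) (f y) :=
  (f.map_fun (n := 2) TreeGraphFunctions.meet ![x, y]).trans (funMap_meet _)

theorem tle_map (f : A ↪[treeGraph] B) (x y : A) : tle (f x) (f y) ↔ tle x y :=
  (relMap_le (f ∘ ![x, y])).symm.trans (f.map_rel (n := 2) TreeGraphRelations.le ![x, y])

theorem tadj_map (f : A ↪[treeGraph] B) (x y : A) : tadj (f x) (f y) ↔ tadj x y :=
  (relMap_adj (f ∘ ![x, y])).symm.trans (f.map_rel (n := 2) TreeGraphRelations.adj ![x, y])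

theorem IsMeetTreeWithGraph.of_embedding (h : IsMeetTreeWithGraph B) (f : A ↪[treeGraph] B) :
    IsMeetTreeWithGraph A := by
  constructor
  all_goals
    intros
    simp only [← tle_map f, ← tadj_map f, map_tmeet] at *
  · exact h.le_refl _
  · rename_i h1 h2; exact f.injective (h.le_antisymm _ _ h1 h2)
  · rename_i h1 h2; exact h.le_trans _ _ _ h1 h2
  · rename_i h1 h2; exact h.comparable_below _ _ _ h1 h2
  · exact h.meet_le_left _ _
  · exact h.meet_le_right _ _
  · rename_i h1 h2; exact h.le_meet _ _ _ h1 h2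
  · rename_i h1; exact h.adj_symm _ _ h1
  · exact h.adj_irrefl _

/-- The meet-semilattice underlying a meet-tree. -/
@[reducible]
def IsMeetTreeWithGraph.toSemilatticeInf (h : IsMeetTreeWithGraph A) : SemilatticeInf A where
  le := tle
  le_refl := h.le_refl
  le_trans := h.le_trans
  le_antisymm := h.le_antisymm
  inf := tmeet
  inf_le_left := h.meet_le_left
  inf_le_right := h.meet_le_right
  le_inf x y z := h.le_meet y z x

end Structures

/-- The left side is the meet of `a ⊓ b`, `a ⊓ c` and `a ⊓ d`. These lie below `a`, so they form a
chain and the meet is the least of them. Hence binary meets of a family are already closed under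
meets. -/
theorem IsTree.exists_inf_inf_eq {X : Type*} [SemilatticeInf X] (hX : IsTree X) (a b c d : X) :
    (a ⊓ b ⊓ (c ⊓ d) = a ⊓ b) ∨ (a ⊓ b ⊓ (c ⊓ d) = a ⊓ c) ∨ (a ⊓ b ⊓ (c ⊓ d) = a ⊓ d) := by
  have e : a ⊓ b ⊓ (c ⊓ d) = (a ⊓ b) ⊓ ((a ⊓ c) ⊓ (a ⊓ d)) := by
    apply le_antisymm
    · refine le_inf inf_le_left (le_inf ?_ ?_)
      · exact inf_le_inf inf_le_left inf_le_left
      · exact inf_le_inf inf_le_left inf_le_right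
    · exact le_inf inf_le_left
        (inf_le_right.trans (inf_le_inf inf_le_right inf_le_right))
  have h1 := hX (inf_le_left : a ⊓ c ≤ a) (inf_le_left : a ⊓ d ≤ a)
  have h2 := hX (inf_le_left : a ⊓ b ≤ a) (inf_le_left : a ⊓ c ≤ a)
  have h3 := hX (inf_le_left : a ⊓ b ≤ a) (inf_le_left : a ⊓ d ≤ a)
  rw [e]
  rcases h1 with h1 | h1
  · rw [inf_eq_left.2 h1]
    rcases h2 with h2 | h2
    · left; rw [inf_eq_left.2 h2]
    · right; left; rw [inf_eq_right.2 h2]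
  · rw [inf_eq_right.2 h1]
    rcases h3 with h3 | h3
    · left; rw [inf_eq_left.2 h3]
    · right; right; rw [inf_eq_right.2 h3]

/-- The set of binary meets of a family. -/
def infRange {ι X : Type*} [SemilatticeInf X] (z : ι → X) : Set X :=
  range fun p : ι × ι => z p.1 ⊓ z p.2

theorem mem_infRange {ι X : Type*} [SemilatticeInf X] (z : ι → X) (p q : ι) :
    z p ⊓ z q ∈ infRange z := ⟨(p, q), rfl⟩

theorem mem_infRange_self {ι X : Type*} [SemilatticeInf X] (z : ι → X) (p : ι) :
    z p ∈ infRange z := ⟨(p, p), inf_idem _⟩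

theorem IsTree.infClosed_infRange {ι X : Type*} [SemilatticeInf X] (hX : IsTree X) (z : ι → X) :
    InfClosed (infRange z) := by
  rintro _ ⟨⟨a, b⟩, rfl⟩ _ ⟨⟨c, d⟩, rfl⟩
  rcases hX.exists_inf_inf_eq (z a) (z b) (z c) (z d) with h | h | h <;> simp only [h]
  exacts [⟨(a, b), rfl⟩, ⟨(a, c), rfl⟩, ⟨(a, d), rfl⟩]

theorem finite_infRange {ι X : Type*} [Finite ι] [SemilatticeInf X] (z : ι → X) :
    (infRange z).Finite := Set.finite_range _

/-! ### Ultrahomogeneity and age of the generic structure -/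

namespace Gen

/-- The substructure on a set closed under meets. -/
def substructureOfInfClosed (s : Set Gen) (hs : InfClosed s) : treeGraph.Substructure Gen where
  carrier := s
  fun_mem {n} f := match n, f with
    | _, TreeGraphFunctions.meet => fun _ hv => hs (hv 0) (hv 1)

theorem infClosed_coe (S : treeGraph.Substructure Gen) : InfClosed (S : Set Gen) := by
  intro x hx y hy
  exact S.fun_mem (n := 2) TreeGraphFunctions.meet ![x, y] (by
    intro i; fin_cases i <;> assumption)

theorem finite_of_fg {S : treeGraph.Substructure Gen} (hS : S.FG) : (S : Set Gen).Finite := by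
  obtain ⟨s, rfl⟩ := hS
  refine (finite_infRange (fun x : s => (x : Gen))).subset ?_
  have : Substructure.closure treeGraph (s : Set Gen) ≤
      substructureOfInfClosed _ (isTree.infClosed_infRange (fun x : s => (x : Gen))) :=
    Substructure.closure_le.2 fun x hx => mem_infRange_self (fun x : s => (x : Gen)) ⟨x, hx⟩
  exact this

theorem coe_tmeet {S : treeGraph.Substructure Gen} (x y : S) :
    ((tmeet x y : S) : Gen) = x.1 ⊓ y.1 := map_tmeet S.subtype x y

/-- A finite partial isomorphism restricts to an embedding of substructures. -/
def embeddingOfPartialIso {S : treeGraph.Substructure Gen} {A : Finset Gen} {f : Gen → Gen}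
    (hf : PartialIso adj A f) (hS : (S : Set Gen) ⊆ A) : S ↪[treeGraph] Gen :=
  mkEmbedding (fun x => f x)
    (fun x y h => Subtype.ext (le_antisymm ((hf.le_iff _ (hS x.2) _ (hS y.2)).1 (le_of_eq h))
      ((hf.le_iff _ (hS y.2) _ (hS x.2)).1 (ge_of_eq h))))
    (fun x y => by
      simp only [coe_tmeet, hf.map_inf _ (hS x.2) _ (hS y.2)]; rfl)
    (fun x y => by
      rw [← tle_map S.subtype]; exact hf.le_iff _ (hS x.2) _ (hS y.2))
    (fun x y => by
      rw [← tadj_map S.subtype]; exact hf.adj_iff _ (hS x.2) _ (hS y.2))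

/-- By countability it suffices to extend an embedding of a finitely generated substructure by one
more generator. Finitely generated substructures are finite, so `PartialIso.exists_extend` applies.
-/
theorem isUltrahomogeneous : treeGraph.IsUltrahomogeneous Gen := by
  classical
  rw [isUltrahomogeneous_iff_IsExtensionPair Structure.cg_of_countable,
    isExtensionPair_iff_exists_embedding_closure_singleton_sup]
  intro S hS f m
  have hfin := finite_of_fg ((Substructure.fg_closure_singleton (L := treeGraph) m).sup hS)
  set T := Substructure.closure treeGraph {m} ⊔ S
  have hST : S ≤ T := le_sup_right
  have hSfin : (S : Set Gen).Finite := hfin.subset hST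
  set f' : Gen → Gen := fun x => if h : x ∈ S then f ⟨x, h⟩ else x
  have hf' : ∀ x (h : x ∈ S), f' x = f ⟨x, h⟩ := fun x h => dif_pos h
  have hpi : PartialIso adj hSfin.toFinset f' := by
    constructor
    all_goals
      intro x hx y hy
      simp only [Set.Finite.mem_toFinset, SetLike.mem_coe] at hx hy
      rw [hf' x hx, hf' y hy]
    · exact (tle_map f _ _).trans (tle_map S.subtype ⟨x, hx⟩ ⟨y, hy⟩).symm
    · have hxy : x ⊓ y ∈ S := infClosed_coe S hx hy
      rw [hf' _ hxy, show (⟨x ⊓ y, hxy⟩ : S) = tmeet ⟨x, hx⟩ ⟨y, hy⟩ from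
        Subtype.ext (coe_tmeet (S := S) ⟨x, hx⟩ ⟨y, hy⟩).symm, map_tmeet]; rfl
    · exact (tadj_map f _ _).trans (tadj_map S.subtype ⟨x, hx⟩ ⟨y, hy⟩).symm
  obtain ⟨g, hg, hgT⟩ := hpi.exists_extend (R := adj) (B := hfin.toFinset) isTree (fun _ _ h => adj_symm h)
    adj_irrefl (by simpa using infClosed_coe T) (by simpa using hST)
    (by simpa using infClosed_coe S)
  refine ⟨embeddingOfPartialIso hgT (by rw [hfin.coe_toFinset]), ?_⟩
  ext x
  have := hg x (by simp)
  rw [hf' _ x.2] at this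
  exact this.symm

theorem age_eq : treeGraph.age Gen = finiteTreeGraphs := by
  classical
  ext N
  constructor
  · rintro ⟨hfg, ⟨f⟩⟩
    refine ⟨?_, isMeetTreeWithGraph.of_embedding f⟩
    have : Finite f.toHom.range := finite_of_fg (hfg.range f.toHom)
    exact Finite.of_injective _ f.equivRange.injective
  · rintro ⟨hfin, hN⟩
    refine ⟨Structure.FG.of_finite, ?_⟩
    let _ := hN.toSemilatticeInf
    have := Fintype.ofFinite N
    have h0 : PartialIso (X := N) tadj ∅ (fun _ => (default : Gen)) := by constructor <;> simp
    obtain ⟨g, -, hg⟩ := h0.exists_extend (R := tadj) (B := Finset.univ) hN.comparable_below hN.adj_symm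
      hN.adj_irrefl (by simp) (by simp) (by simp)
    exact ⟨mkEmbedding g (fun x y h => le_antisymm ((hg.le_iff _ (by simp) _ (by simp)).1 h.le)
        ((hg.le_iff _ (by simp) _ (by simp)).1 h.ge))
      (fun x y => hg.map_inf x (by simp) y (by simp)) (fun x y => hg.le_iff x (by simp) y (by simp))
      (fun x y => hg.adj_iff x (by simp) y (by simp))⟩

theorem isFraisseLimit : IsFraisseLimit finiteTreeGraphs Gen :=
  ⟨isUltrahomogeneous, age_eq⟩

/-- Two finite families with the same quantifier-free type are conjugate. -/
theorem exists_equiv_of_forall_iff {ι : Type*} [Finite ι] (z z' : ι → Gen)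
    (hQ : ∀ p q r, z p ⊓ z q ≤ z r ↔ z' p ⊓ z' q ≤ z' r)
    (hR : ∀ p q r s, adj (z p ⊓ z q) (z r ⊓ z s) ↔ adj (z' p ⊓ z' q) (z' r ⊓ z' s)) :
    ∃ σ : Gen ≃[treeGraph] Gen, ∀ p, σ (z p) = z' p := by
  classical
  have hle : ∀ p q r s, z p ⊓ z q ≤ z r ⊓ z s ↔ z' p ⊓ z' q ≤ z' r ⊓ z' s := by
    intro p q r s
    rw [le_inf_iff, le_inf_iff, hQ, hQ]
  have heq : ∀ p q r s, z p ⊓ z q = z r ⊓ z s ↔ z' p ⊓ z' q = z' r ⊓ z' s := by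
    intro p q r s
    rw [le_antisymm_iff, le_antisymm_iff, hle, hle]
  -- A meet of two binary meets reduces to a binary meet in each family, a priori with different
  -- indices; the equivalence `hle` shows that the indices found for `z` also serve for `z'`.
  have hinf : ∀ p q r s, ∃ a b, z p ⊓ z q ⊓ (z r ⊓ z s) = z a ⊓ z b ∧
      z' p ⊓ z' q ⊓ (z' r ⊓ z' s) = z' a ⊓ z' b := by
    intro p q r s
    have h1 : ∃ a b, z p ⊓ z q ⊓ (z r ⊓ z s) = z a ⊓ z b := by
      obtain ⟨⟨a, b⟩, h⟩ := isTree.infClosed_infRange z (mem_infRange z p q) (mem_infRange z r s)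
      exact ⟨a, b, h.symm⟩
    have h2 : ∃ a b, z' p ⊓ z' q ⊓ (z' r ⊓ z' s) = z' a ⊓ z' b := by
      obtain ⟨⟨a, b⟩, h⟩ := isTree.infClosed_infRange z' (mem_infRange z' p q)
        (mem_infRange z' r s)
      exact ⟨a, b, h.symm⟩
    obtain ⟨a, b, h1⟩ := h1
    obtain ⟨c, d, h2⟩ := h2
    refine ⟨a, b, h1, ?_⟩
    apply le_antisymm
    · rw [h2, ← hle, ← h1]
      exact le_inf ((hle _ _ _ _).2 (h2 ▸ inf_le_left)) ((hle _ _ _ _).2 (h2 ▸ inf_le_right))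
    · exact le_inf ((hle _ _ _ _).1 (h1 ▸ inf_le_left)) ((hle _ _ _ _).1 (h1 ▸ inf_le_right))
  set S := substructureOfInfClosed _ (isTree.infClosed_infRange z)
  have hS : S.FG := by
    have : Finite S := finite_infRange z
    exact Substructure.FG.of_finite
  choose c hc using fun x : S => (x.2 : x.1 ∈ infRange z)
  set f : S → Gen := fun x => z' (c x).1 ⊓ z' (c x).2
  have hf : ∀ (x : S) p q, x.1 = z p ⊓ z q → f x = z' p ⊓ z' q := fun x p q h => by
    rw [← hc x] at h
    exact (heq _ _ _ _).1 h
  have hfle : ∀ x y : S, f x ≤ f y ↔ x.1 ≤ y.1 := fun x y => by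
    rw [← hc x, ← hc y]; exact (hle _ _ _ _).symm
  obtain ⟨σ, hσ⟩ := isUltrahomogeneous S hS (mkEmbedding f
    (fun x y h => Subtype.ext (le_antisymm ((hfle _ _).1 h.le) ((hfle _ _).1 h.ge)))
    (fun x y => by
      obtain ⟨a, b, h1, h2⟩ := hinf (c x).1 (c x).2 (c y).1 (c y).2
      rw [hf (tmeet x y) a b, tmeet_eq, ← h2]
      rw [coe_tmeet, ← hc x, ← hc y]; exact h1)
    (fun x y => (hfle x y).trans (tle_map S.subtype x y))
    (fun x y => by
      rw [← tadj_map S.subtype]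
      change adj (f x) (f y) ↔ adj x.1 y.1
      rw [← hc x, ← hc y]; exact (hR _ _ _ _).symm))
  refine ⟨σ, fun p => ?_⟩
  have h1 := DFunLike.congr_fun hσ ⟨z p, mem_infRange_self z p⟩
  have h2 := hf ⟨z p, mem_infRange_self z p⟩ p p (inf_idem _).symm
  rw [inf_idem] at h2
  exact h1.symm.trans h2

end Gen

/-! ### Finite Ramsey theorem for infinitely many points -/

section Ramsey

variable {κ : Type*} [Finite κ]

theorem exists_eventually_eq (f : ℕ → κ) :
    ∃ c, ∀ᶠ j in (Filter.hyperfilter ℕ : Filter ℕ), f j = c := by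
  obtain ⟨c, hc⟩ := Ultrafilter.eq_pure_of_finite ((Filter.hyperfilter ℕ).map f)
  refine ⟨c, ?_⟩
  have : {c} ∈ (Filter.hyperfilter ℕ).map f := by rw [hc]; exact Ultrafilter.mem_pure.2 rfl
  exact this

/-- The limit colour of a list followed by `n` generic points. -/
def limitColor (F : List ℕ → κ) : ℕ → List ℕ → κ
  | 0, s => F s
  | n + 1, s => (exists_eventually_eq fun j => limitColor F n (j :: s)).choose

theorem eventually_limitColor (F : List ℕ → κ) (n : ℕ) (s : List ℕ) :
    ∀ᶠ j in (Filter.hyperfilter ℕ : Filter ℕ),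
      limitColor F n (j :: s) = limitColor F (n + 1) s :=
  (exists_eventually_eq fun j => limitColor F n (j :: s)).choose_spec

/-- Points are chosen one after another, each generic for the finitely many limit colours of
sublists chosen so far. The limit colour then depends only on the total length. New points are
larger and enter at the head, which is why the list decreases. -/
theorem exists_list_limitColor (F : List ℕ → κ) (m P : ℕ) :
    ∃ L : List ℕ, L.length = P ∧ L.Pairwise (· > ·) ∧ ∀ s, s.Sublist L → ∀ n, n + s.length ≤ m →
      limitColor F n s = limitColor F (n + s.length) [] := by
  induction P with
  | zero =>
    refine ⟨[], rfl, List.Pairwise.nil, fun s hs n _ => ?_⟩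
    obtain rfl := List.sublist_nil.1 hs
    rfl
  | succ P ih =>
    obtain ⟨L, hL, hp, hs⟩ := ih
    have h1 : ∀ᶠ j in (Filter.hyperfilter ℕ : Filter ℕ), ∀ s ∈ L.sublists.toFinset,
        ∀ n ∈ Finset.range (m + 1), limitColor F n (j :: s) = limitColor F (n + 1) s :=
      (Filter.eventually_all_finset _).2 fun s _ => (Filter.eventually_all_finset _).2 fun n _ =>
        eventually_limitColor F n s
    have h2 : ∀ᶠ j in (Filter.hyperfilter ℕ : Filter ℕ), ∀ x ∈ L.toFinset, j > x :=
      (Filter.eventually_all_finset _).2 fun x _ =>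
        Filter.mem_of_superset
          (Filter.hyperfilter_le_cofinite (Set.finite_Iic x).compl_mem_cofinite)
          fun y (hy : ¬ y ≤ x) => lt_of_not_ge hy
    obtain ⟨j, hj1, hj2⟩ := (h1.and h2).exists
    refine ⟨j :: L, by simp [hL], List.pairwise_cons.2 ⟨fun x hx => hj2 x (by simpa), hp⟩, ?_⟩
    intro s hsL n hn
    rcases List.sublist_cons_iff.1 hsL with h | ⟨r, rfl, hr⟩
    · exact hs s h n hn
    · simp only [List.length_cons] at hn ⊢
      rw [hj1 r (by simpa) n (by simp; omega), hs r hr (n + 1) (by omega)]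
      congr 1
      omega

theorem exists_strictAnti_homogeneous {m : ℕ} (χ : (Fin m → ℕ) → κ) (P : ℕ) :
    ∃ j : Fin P → ℕ, StrictAnti j ∧ ∀ p q : Fin m → Fin P, (∀ a b, p a < p b ↔ q a < q b) →
      χ (j ∘ p) = χ (j ∘ q) := by
  classical
  obtain ⟨L, rfl, hp, hs⟩ := exists_list_limitColor
    -- The colour of a list records the `χ`-colours of all `m`-tuples that can be read from its
    -- entries, so that repetitions and arbitrary orders are covered.
    (fun s => fun h : Fin m → Fin m => χ fun a => s.getD (h a) 0) m P
  refine ⟨L.get, fun a b hab => List.pairwise_iff_get.1 hp a b hab, ?_⟩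
  have key : ∀ (k : ℕ) (e e' : Fin k → Fin L.length) (pos : Fin m → Fin k), k ≤ m → StrictMono e →
      StrictMono e' → χ (L.get ∘ (e ∘ pos)) = χ (L.get ∘ (e' ∘ pos)) := by
    intro k e e' pos hk he he'
    have hsub : ∀ e : Fin k → Fin L.length, StrictMono e →
        χ (L.get ∘ (e ∘ pos)) = limitColor
          (fun s => fun h : Fin m → Fin m => χ fun a => s.getD (h a) 0) k []
          (fun a => (pos a).castLE hk) := by
      intro e he
      have h1 : (List.ofFn (L.get ∘ e)).Sublist L := by
        rw [List.sublist_iff_exists_fin_orderEmbedding_get_eq]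
        refine ⟨(Fin.castOrderIso (by simp)).toOrderEmbedding.trans
          (OrderEmbedding.ofStrictMono e he), fun i => ?_⟩
        simp only [List.get_eq_getElem, List.getElem_ofFn]
        rfl
      have h2 := congrFun (hs _ h1 0 (by simpa)) (fun a => (pos a).castLE hk)
      simp only [List.length_ofFn, zero_add] at h2
      rw [← h2]
      simp only [limitColor]
      congr 1
      ext a
      simp
    rw [hsub e he, hsub e' he']
  intro p q hpq
  have heq : ∀ a b, p a = p b ↔ q a = q b := by
    intro a b
    have h1 := hpq a b
    have h2 := hpq b a
    constructor <;> intro h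
    · rw [h] at h1 h2; simp only [lt_irrefl, false_iff, not_lt] at h1 h2; exact le_antisymm h2 h1
    · rw [h] at h1 h2; simp only [lt_irrefl, iff_false, not_lt] at h1 h2; exact le_antisymm h2 h1
  -- The tuple `p` factors as a position map followed by the increasing enumeration of its values.
  -- Since `q` has the same order pattern, it factors through the same positions.
  set S := Finset.univ.image p
  have hmem : ∀ i : Fin S.card, ∃ a, p a = S.orderEmbOfFin rfl i := fun i => by
    obtain ⟨a, -, ha⟩ := Finset.mem_image.1 (S.orderEmbOfFin_mem rfl i)
    exact ⟨a, ha⟩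
  choose c hc using hmem
  have hpos : ∀ a, ∃ i, S.orderEmbOfFin rfl i = p a := fun a => by
    have : p a ∈ Set.range (S.orderEmbOfFin rfl) := by
      rw [Finset.range_orderEmbOfFin]; simp [S]
    exact this
  choose pos hpos using hpos
  have h1 := key S.card (S.orderEmbOfFin rfl) (fun i => q (c i)) pos
    (Finset.card_image_le.trans (by simp)) (S.orderEmbOfFin rfl).strictMono (fun i i' h => by
      rw [← hpq, hc, hc]; exact (S.orderEmbOfFin rfl).strictMono h)
  convert! h1 using 3
  · ext a; simp [hpos]
  · ext a
    simp only [Function.comp]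
    rw [(heq a (c (pos a))).1 (by rw [hc, hpos])]

/-- Among infinitely many points one finds arbitrarily long finite sequences which are homogeneous
for a finite colouring of `m`-tuples. -/
theorem exists_strictMono_homogeneous {m : ℕ} (χ : (Fin m → ℕ) → κ) (P : ℕ) :
    ∃ j : Fin P → ℕ, StrictMono j ∧ ∀ p q : Fin m → Fin P, (∀ a b, p a < p b ↔ q a < q b) →
      χ (j ∘ p) = χ (j ∘ q) := by
  obtain ⟨j, hj, h⟩ := exists_strictAnti_homogeneous χ P
  refine ⟨j ∘ Fin.rev, fun a b hab => hj (Fin.rev_lt_rev.2 hab), fun p q hpq => ?_⟩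
  exact h (Fin.rev ∘ p) (Fin.rev ∘ q) fun a b => by simp [hpq]

end Ramsey

/-! ### Mutually indiscernible rows in a tree -/

section Rows

variable {X : Type*} [SemilatticeInf X] {N : ℕ}

/-- The rows `pt ⟨i, t⟩ k` are mutually indiscernible with respect to the tree structure. -/
def MutuallyIndiscernible {I : Type*} {E : I → Type*} (pt : (Σ i, E i) → Fin N → X) : Prop :=
  ∀ (d : Fin 3 → Σ i, E i) (k l : Fin 3 → Fin N),
    (∀ a b, (d a).1 = (d b).1 → (k a < k b ↔ l a < l b)) →
      (pt (d 0) (k 0) ⊓ pt (d 1) (k 1) ≤ pt (d 2) (k 2) ↔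
        pt (d 0) (l 0) ⊓ pt (d 1) (l 1) ≤ pt (d 2) (l 2))

theorem MutuallyIndiscernible.le_iff {I : Type*} {E : I → Type*} {pt : (Σ i, E i) → Fin N → X}
    (h : MutuallyIndiscernible pt) {ι : Type*} (d : ι → Σ i, E i) (k l : ι → Fin N)
    (hkl : ∀ a b, (d a).1 = (d b).1 → (k a < k b ↔ l a < l b)) (p q r : ι) :
    pt (d p) (k p) ⊓ pt (d q) (k q) ≤ pt (d r) (k r) ↔
      pt (d p) (l p) ⊓ pt (d q) (l q) ≤ pt (d r) (l r) :=
  h (fun a => d (![p, q, r] a)) (fun a => k (![p, q, r] a)) (fun a => l (![p, q, r] a))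
    fun _ _ => hkl _ _

/-- The relations between `c` and one or two elements of the row `q` depend only on the order of
their columns. -/
structure IsUniform {E : Type*} (q : E → Fin N → X) (c : X) : Prop where
  le_iff : ∀ t k l, c ≤ q t k ↔ c ≤ q t l
  inf_le_iff : ∀ t t' k k' l l', (k < k' ↔ l < l') → (k' < k ↔ l' < l) →
    (q t k ⊓ q t' k' ≤ c ↔ q t l ⊓ q t' l' ≤ c)
  inf_le_iff' : ∀ t t' k k' l l', (k < k' ↔ l < l') → (k' < k ↔ l' < l) →
    (c ⊓ q t k ≤ q t' k' ↔ c ⊓ q t l ≤ q t' l')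

/-- Membership in the closed cone above `y ⊓ y'` and in the open cone of `y` above `y ⊓ y'`. -/
def InCone (closed : Bool) (y y' x : X) : Prop :=
  if closed then y ⊓ y' ≤ x else ¬ x ⊓ y ≤ y'

theorem InCone.mono {s : Bool} {y y' x x' : X} (h : InCone s y y' x) (hx : x ≤ x') :
    InCone s y y' x' := by
  cases s
  · exact fun h' => h ((inf_le_inf_right _ hx).trans h')
  · exact le_trans h hx

theorem InCone.inf (hX : IsTree X) {s : Bool} {y y' x x' : X} (h : InCone s y y' x)
    (h' : InCone s y y' x') : InCone s y y' (x ⊓ x') := by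
  cases s
  · intro h3
    rcases hX (inf_le_right : x ⊓ y ≤ y) (inf_le_right : x' ⊓ y ≤ y) with h1 | h1
    · exact h (le_trans (le_inf (le_inf inf_le_left (h1.trans inf_le_left)) inf_le_right) h3)
    · exact h' (le_trans (le_inf (le_inf (h1.trans inf_le_left) inf_le_left) inf_le_right) h3)
  · exact le_inf h h'

/-- Inclusion of cones, expressed by relations between three of the four elements. -/
def ConeSubset : Bool → Bool → X → X → X → X → Prop
  | true, true, y, y', w, w' => w ⊓ w' ≤ y ∧ w ⊓ w' ≤ y'
  | true, false, y, y', w, w' => ¬ y ⊓ y' ≤ w' ∧ ¬ y ⊓ w ≤ w'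
  | false, true, y, y', w, w' => w ⊓ w' ≤ y ∧ w ⊓ w' ≤ y'
  | false, false, y, y', w, w' => ¬ y ⊓ w ≤ w' ∧ w ⊓ w' ≤ y ∧ w ⊓ w' ≤ y'

theorem inf_le_of_inCone (hX : IsTree X) {s : Bool} {y y' x : X} (h : InCone s y y' x) :
    y ⊓ y' ≤ x := by
  cases s
  · rcases hX (inf_le_left : y ⊓ y' ≤ y) (inf_le_right : x ⊓ y ≤ y) with h1 | h1
    · exact h1.trans inf_le_left
    · exact absurd (h1.trans inf_le_right) h
  · exact h

theorem ConeSubset.inCone (hX : IsTree X) {s t : Bool} {y y' w w' x : X}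
    (h : ConeSubset s t y y' w w') (hx : InCone s y y' x) : InCone t w w' x := by
  cases s <;> cases t
  · obtain ⟨h1, h2, h3⟩ := h
    intro h4
    rcases hX (inf_le_right : x ⊓ y ≤ y) (inf_le_left : y ⊓ w ≤ y) with h5 | h5
    · have h6 : x ⊓ y ≤ x ⊓ w := le_inf inf_le_left (h5.trans inf_le_right)
      exact hx (((le_inf (h6.trans inf_le_right) (h6.trans h4))).trans h3)
    · exact h1 (le_trans (le_inf (h5.trans inf_le_left) inf_le_right) h4)
  · exact le_trans (le_inf h.1 h.2) (inf_le_of_inCone hX hx)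
  · intro h4
    rcases hX (inf_le_left : y ⊓ y' ≤ y) (inf_le_left : y ⊓ w ≤ y) with h5 | h5
    · exact h.1 (le_trans (le_inf hx (h5.trans inf_le_right)) h4)
    · exact h.2 (le_trans (le_inf (h5.trans hx) inf_le_right) h4)
  · exact le_trans (le_inf h.1 h.2) hx

/-- Two cones through `x` have their base points below `x`, hence comparable, and this makes the
cones nested. `ConeSubset` is phrased by relations among at most three of the four elements, so that
mutual indiscernibility can transfer it. -/
theorem coneSubset_or (hX : IsTree X) {s t : Bool} {y y' w w' x : X}
    (hs : InCone s y y' x) (ht : InCone t w w' x) :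
    ConeSubset s t y y' w w' ∨ ConeSubset t s w w' y y' := by
  have h1 := inf_le_of_inCone hX hs
  have h2 := inf_le_of_inCone hX ht
  have h3 := hX h1 h2
  cases s <;> cases t
  · have key : ∀ {y y' w w' : X}, ¬ x ⊓ y ≤ y' → ¬ x ⊓ w ≤ w' → w ⊓ w' ≤ y ⊓ y' →
        ¬ y ⊓ w ≤ w' := by
      intro y y' w w' hs ht hle h
      rcases hX (inf_le_left : x ⊓ y ≤ x) (inf_le_left : x ⊓ w ≤ x) with h4 | h4
      · refine hs (le_trans (le_inf (h4.trans inf_le_right) ?_) (hle.trans inf_le_right))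
        exact le_trans (le_inf inf_le_right (h4.trans inf_le_right)) h
      · exact ht (le_trans (le_inf (h4.trans inf_le_right) inf_le_right) h)
    rcases h3 with h3 | h3
    · exact .inr ⟨key ht hs h3, le_inf_iff.1 h3⟩
    · exact .inl ⟨key hs ht h3, le_inf_iff.1 h3⟩
  · by_cases h4 : w ⊓ w' ≤ y ⊓ y'
    · exact .inl (le_inf_iff.1 h4)
    · refine .inr ⟨fun h5 => ?_, fun h5 => ?_⟩
      · rcases hX (inf_le_left : x ⊓ y ≤ x) ht with h6 | h6
        · exact hs (h6.trans h5)
        · exact h4 (le_inf (h6.trans inf_le_right) h5)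
      · rcases hX (inf_le_left : x ⊓ y ≤ x) ht with h6 | h6
        · exact hs ((le_inf (h6.trans inf_le_left) inf_le_right).trans h5)
        · exact h4 (le_inf (h6.trans inf_le_right)
            (le_trans (le_inf inf_le_left (h6.trans inf_le_right)) h5))
  · by_cases h4 : y ⊓ y' ≤ w ⊓ w'
    · exact .inr (le_inf_iff.1 h4)
    · refine .inl ⟨fun h5 => ?_, fun h5 => ?_⟩
      · rcases hX (inf_le_left : x ⊓ w ≤ x) hs with h6 | h6
        · exact ht (h6.trans h5)
        · exact h4 (le_inf (h6.trans inf_le_right) h5)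
      · rcases hX (inf_le_left : x ⊓ w ≤ x) hs with h6 | h6
        · exact ht ((le_inf (h6.trans inf_le_left) inf_le_right).trans h5)
        · exact h4 (le_inf (h6.trans inf_le_right)
            (le_trans (le_inf inf_le_left (h6.trans inf_le_right)) h5))
  · exact h3.symm.imp le_inf_iff.1 le_inf_iff.1

/-- A segment below an element of the row separates `c` from uniformity. -/
def SegmentSeparates {E : Type*} (q : E → Fin N → X) (c : X) : Prop :=
  ∃ t k l, c ≤ q t k ∧ ¬ c ≤ q t l

/-- A cone given by elements of the row separates `c` from uniformity. -/
def ConeSeparates {E : Type*} (q : E → Fin N → X) (c : X) : Prop :=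
  ∃ s t t' k k' l l', (k < k' ↔ l < l') ∧ (k' < k ↔ l' < l) ∧
    InCone s (q t k) (q t' k') c ∧ ¬ InCone s (q t l) (q t' l') c

/-- The clauses of `IsUniform` concern segments, closed cones and open cones respectively. A failure
of one of them is an instance whose truth changes with the columns. -/
theorem separates_of_not_isUniform {E : Type*} {q : E → Fin N → X} {c : X}
    (h : ¬ IsUniform q c) : SegmentSeparates q c ∨ ConeSeparates q c := by
  by_contra! h'
  obtain ⟨h1, h2⟩ := h'
  refine h ⟨?_, ?_, ?_⟩
  · intro t k l
    by_contra h3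
    rcases not_iff.1 h3 with h3
    by_cases h4 : c ≤ q t l
    · exact h1 ⟨t, l, k, h4, h3.2 h4⟩
    · exact h1 ⟨t, k, l, by tauto, h4⟩
  · intro t t' k k' l l' ha hb
    by_contra h3
    by_cases h4 : q t l ⊓ q t' l' ≤ c
    · exact h2 ⟨true, t, t', l, l', k, k', ha.symm, hb.symm, h4, show ¬ _ by tauto⟩
    · exact h2 ⟨true, t, t', k, k', l, l', ha, hb, show q t k ⊓ q t' k' ≤ c by tauto, h4⟩
  · intro t t' k k' l l' ha hb
    by_contra h3
    by_cases h4 : c ⊓ q t l ≤ q t' l'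
    · exact h2 ⟨false, t, t', k, k', l, l', ha, hb, show ¬ _ by tauto, not_not.2 h4⟩
    · exact h2 ⟨false, t, t', l, l', k, k', ha.symm, hb.symm, h4,
        not_not.2 (show c ⊓ q t k ≤ q t' k' by tauto)⟩

variable {I : Type*} {E : I → Type*} {pt : (Σ i, E i) → Fin N → X}

/-- A relation between two pairs from different rows does not change when the columns of both
pairs change. -/
theorem MutuallyIndiscernible.le_iff_four (h : MutuallyIndiscernible pt) {i i' : I} (hi : i ≠ i')
    (t t' : E i) (w w' : E i') {k k' l l' m m' n n' : Fin N} (h1 : k < k' ↔ l < l')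
    (h2 : k' < k ↔ l' < l) (h3 : m < m' ↔ n < n') (h4 : m' < m ↔ n' < n) (p q r : Fin 4) :
    ![pt ⟨i, t⟩ k, pt ⟨i, t'⟩ k', pt ⟨i', w⟩ m, pt ⟨i', w'⟩ m'] p ⊓
      ![pt ⟨i, t⟩ k, pt ⟨i, t'⟩ k', pt ⟨i', w⟩ m, pt ⟨i', w'⟩ m'] q ≤
      ![pt ⟨i, t⟩ k, pt ⟨i, t'⟩ k', pt ⟨i', w⟩ m, pt ⟨i', w'⟩ m'] r ↔
    ![pt ⟨i, t⟩ l, pt ⟨i, t'⟩ l', pt ⟨i', w⟩ n, pt ⟨i', w'⟩ n'] p ⊓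
      ![pt ⟨i, t⟩ l, pt ⟨i, t'⟩ l', pt ⟨i', w⟩ n, pt ⟨i', w'⟩ n'] q ≤
      ![pt ⟨i, t⟩ l, pt ⟨i, t'⟩ l', pt ⟨i', w⟩ n, pt ⟨i', w'⟩ n'] r := by
  have key := h.le_iff ![⟨i, t⟩, ⟨i, t'⟩, ⟨i', w⟩, ⟨i', w'⟩] ![k, k', m, m'] ![l, l', n, n'] (by
    intro a b hab
    fin_cases a <;> fin_cases b <;> simp_all [Ne.symm hi]) p q r
  have e : ∀ k k' m m' : Fin N, (fun a => pt (![⟨i, t⟩, ⟨i, t'⟩, ⟨i', w⟩, ⟨i', w'⟩] a)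
      (![k, k', m, m'] a)) = ![pt ⟨i, t⟩ k, pt ⟨i, t'⟩ k', pt ⟨i', w⟩ m, pt ⟨i', w'⟩ m'] := by
    intro k k' m m'
    ext a
    fin_cases a <;> rfl
  rw [← e, ← e]
  exact key

theorem coneSubset_congr {s t : Bool} {z z' : Fin 4 → X}
    (h : ∀ p q r, z p ⊓ z q ≤ z r ↔ z' p ⊓ z' q ≤ z' r) :
    (ConeSubset s t (z 0) (z 1) (z 2) (z 3) ↔ ConeSubset s t (z' 0) (z' 1) (z' 2) (z' 3)) ∧
    (ConeSubset s t (z 2) (z 3) (z 0) (z 1) ↔ ConeSubset s t (z' 2) (z' 3) (z' 0) (z' 1)) ∧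
    (InCone s (z 2) (z 3) (z 0) ↔ InCone s (z' 2) (z' 3) (z' 0)) := by
  cases s <;> cases t <;> simp only [ConeSubset, InCone, h, if_true, Bool.false_eq_true, if_false,
    and_self]

/-- The element `c` lies below one element `a` of the first row and not below another one, `a'`.
Since `a` is in the cone through `c`, indiscernibility puts both `a` and `a'`, hence `a ⊓ a'`, in
the moved cone. But `c` lies above `a ⊓ a'`, so it is in the moved cone too. -/
theorem MutuallyIndiscernible.not_segmentSeparates_coneSeparates (hX : IsTree X)
    (h : MutuallyIndiscernible pt) {i i' : I} (hi : i ≠ i') {c : X}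
    (h1 : SegmentSeparates (fun t => pt ⟨i, t⟩) c) (h2 : ConeSeparates (fun t => pt ⟨i', t⟩) c) :
    False := by
  obtain ⟨t, k, l, hk, hl⟩ := h1
  obtain ⟨s, w, w', m, m', n, n', hm, hm', hc, hc'⟩ := h2
  have hmove : ∀ {k l m m' n n' : Fin N}, (m < m' ↔ n < n') → (m' < m ↔ n' < n) →
      (InCone s (pt ⟨i', w⟩ m) (pt ⟨i', w'⟩ m') (pt ⟨i, t⟩ k) ↔
        InCone s (pt ⟨i', w⟩ n) (pt ⟨i', w'⟩ n') (pt ⟨i, t⟩ l)) := fun {k l m m' n n'} h3 h4 =>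
    (coneSubset_congr (s := s) (t := s) (h.le_iff_four hi t t w w' (k := k) (k' := k) (l := l)
      (l' := l) (by simp) (by simp) h3 h4)).2.2
  have h3 := hc.mono hk
  have h4 := ((hmove (k := k) (l := k) hm hm').1 h3).inf hX ((hmove (k := k) (l := l) hm hm').1 h3)
  rcases hX hk (inf_le_left : pt ⟨i, t⟩ k ⊓ pt ⟨i, t⟩ l ≤ _) with h5 | h5
  · exact hl (h5.trans inf_le_right)
  · exact hc' (h4.mono h5)

/-- Of two mutually indiscernible rows, one is uniform over a given element. -/
theorem MutuallyIndiscernible.isUniform_or (hX : IsTree X) (h : MutuallyIndiscernible pt)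
    {i i' : I} (hi : i ≠ i') (c : X) :
    IsUniform (fun t => pt ⟨i, t⟩) c ∨ IsUniform (fun t => pt ⟨i', t⟩) c := by
  by_contra! hc
  rcases separates_of_not_isUniform hc.1 with h1 | h1 <;>
    rcases separates_of_not_isUniform hc.2 with h2 | h2
  · obtain ⟨t, u, v, hu, hv⟩ := h1
    obtain ⟨w, p, q, hp, hq⟩ := h2
    have key := fun u v p q => h.le_iff_four hi t t w w (k := u) (k' := v) (l := u)
      (l' := v) (m := p) (m' := p) (n := q) (n' := q) (by simp) (by simp) (by simp) (by simp)
    have key' := fun u v p q => h.le_iff_four hi t t w w (k := u) (k' := u) (l := v)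
      (l' := v) (m := p) (m' := q) (n := p) (n' := q) (by simp) (by simp) (by simp) (by simp)
    have a1 : ¬ pt ⟨i, t⟩ u ⊓ pt ⟨i', w⟩ p ≤ pt ⟨i, t⟩ v := fun h' => hv ((le_inf hu hp).trans h')
    have a2 : ¬ pt ⟨i, t⟩ u ⊓ pt ⟨i', w⟩ q ≤ pt ⟨i, t⟩ v := fun h' =>
      a1 ((key u v p q 0 2 1).2 h')
    have b1 : ¬ pt ⟨i, t⟩ u ⊓ pt ⟨i', w⟩ p ≤ pt ⟨i', w⟩ q := fun h' => hq ((le_inf hu hp).trans h')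
    have b2 : ¬ pt ⟨i, t⟩ v ⊓ pt ⟨i', w⟩ p ≤ pt ⟨i', w⟩ q := fun h' =>
      b1 ((key' u v p q 0 2 3).2 h')
    clear key key'
    generalize pt ⟨i, t⟩ u = au at *
    generalize pt ⟨i, t⟩ v = av at *
    generalize pt ⟨i', w⟩ p = bp at *
    generalize pt ⟨i', w⟩ q = bq at *
    -- Both `av ⊓ bp` and `au ⊓ bq` lie below `au ⊓ bp`, so they are comparable; either comparison
    -- contradicts one of the relations moved by indiscernibility.
    have c1 : av ⊓ bp ≤ au ⊓ bp := (hX (inf_le_right : au ⊓ bp ≤ bp) inf_le_right).resolve_left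
      fun h' => a1 (h'.trans inf_le_left)
    have c2 : au ⊓ bq ≤ au ⊓ bp := (hX (inf_le_left : au ⊓ bp ≤ au) inf_le_left).resolve_left
      fun h' => b1 (h'.trans inf_le_right)
    rcases hX c1 c2 with h' | h'
    · exact b2 (h'.trans inf_le_right)
    · exact a2 (h'.trans inf_le_left)
  · exact h.not_segmentSeparates_coneSeparates hX hi h1 h2
  · exact h.not_segmentSeparates_coneSeparates hX hi.symm h2 h1
  · obtain ⟨s, t, t', k, k', l, l', h3, h4, hc1, hc1'⟩ := h1
    obtain ⟨s', w, w', m, m', n, n', h5, h6, hc2, hc2'⟩ := h2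
    -- The two cones through `c` are nested. Moving only the columns of the larger one preserves the
    -- inclusion, so `c` stays in the moved cone.
    rcases coneSubset_or hX hc1 hc2 with h7 | h7
    · exact hc2' (ConeSubset.inCone hX ((coneSubset_congr (h.le_iff_four hi t t' w w' (k := k)
        (k' := k') (l := k) (l' := k') (by simp) (by simp) h5 h6)).1.1 h7) hc1)
    · exact hc1' (ConeSubset.inCone hX ((coneSubset_congr (h.le_iff_four hi t t' w w' (m := m)
        (m' := m') (n := m) (n' := m') h3 h4 (by simp) (by simp))).2.1.1 h7) hc2)

/-! ### Rows which are indiscernible over a tuple -/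

variable {S E : Type*}

/-- The tuple consisting of `c` and the `k`-th column of `q`. -/
def joinTuple (c : S → X) (q : E → Fin N → X) (k : Fin N) : S ⊕ E → X :=
  Sum.elim c fun t => q t k

/-- The row `q` is indiscernible over `c` with respect to the tree structure. -/
def IndiscernibleOver (c : S → X) (q : E → Fin N → X) : Prop :=
  ∀ (e : Fin 3 → S ⊕ E) (k l : Fin 3 → Fin N), (∀ a b, k a < k b ↔ l a < l b) →
    (joinTuple c q (k 0) (e 0) ⊓ joinTuple c q (k 1) (e 1) ≤ joinTuple c q (k 2) (e 2) ↔
      joinTuple c q (l 0) (e 0) ⊓ joinTuple c q (l 1) (e 1) ≤ joinTuple c q (l 2) (e 2))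

/-- If column `k` leaves `c` at or below `e` while column `l` follows `c` beyond `e`, uniformity
copies this asymmetry to every pair of columns ordered like `k, l`. A third column then takes part
in incompatible pairs, whether it comes before, between or after them. -/
theorem IsUniform.inf_le_imp (hX : IsTree X) (hN : 3 ≤ N) {q : E → Fin N → X} {c e : X}
    (hc : IsUniform q c) (he : IsUniform q e) (hec : e ≤ c) (t : E) (k l : Fin N)
    (hk : c ⊓ q t k ≤ e) : c ⊓ q t l ≤ e := by
  by_contra hl
  have h1 : e ≤ q t l := ((hX (inf_le_left : c ⊓ q t l ≤ c) hec).resolve_left hl).trans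
    inf_le_right
  have h2 : ∀ j, e ≤ q t j := fun j => (he.le_iff t l j).1 h1
  have hkl : c ⊓ q t k ≤ q t l := hk.trans h1
  have hlk : ¬ c ⊓ q t l ≤ q t k := fun h => hl ((le_inf inf_le_left h).trans hk)
  have hq : q t k ⊓ q t l ≤ e := by
    rcases hX (inf_le_right : c ⊓ q t l ≤ q t l) (inf_le_right : q t k ⊓ q t l ≤ q t l) with h | h
    · exact absurd (h.trans inf_le_left) hlk
    · exact le_trans (le_inf (h.trans inf_le_left) inf_le_left) hk
  have hne : k ≠ l := by rintro rfl; exact hl hk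
  obtain ⟨j, hjk, hjl⟩ : ∃ j : Fin N, j ≠ k ∧ j ≠ l := by
    by_contra! h
    have : (Finset.univ : Finset (Fin N)) ⊆ {k, l} := fun j _ => by
      by_cases hj : j = k
      · simp [hj]
      · simp [h j hj]
    have := Finset.card_le_card this
    have h2 := Finset.card_le_two (a := k) (b := l)
    simp at this
    omega
  have key : ∀ k₁ k₂ : Fin N, (k < l ↔ k₁ < k₂) → (l < k ↔ k₂ < k₁) →
      c ⊓ q t k₁ ≤ q t k₂ ∧ ¬ c ⊓ q t k₂ ≤ q t k₁ ∧ q t k₁ ⊓ q t k₂ ≤ e := fun k₁ k₂ h3 h4 =>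
    ⟨(hc.inf_le_iff' t t _ _ _ _ h3 h4).1 hkl, fun h => hlk ((hc.inf_le_iff' t t _ _ _ _ h4 h3).2 h),
      (he.inf_le_iff t t _ _ _ _ h3 h4).1 hq⟩
  have h3 : ¬ ((k < l ↔ l < j) ∧ (l < k ↔ j < l)) := fun h => by
    obtain ⟨a1, -, a3⟩ := key l j h.1 h.2
    exact hl (le_trans (le_inf inf_le_right a1) a3)
  have h4 : ¬ ((k < l ↔ j < l ∧ k < j) ∧ (l < k ↔ l < j ∧ j < k)) := fun h => by
    rcases lt_or_gt_of_ne hne with h' | h'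
    · obtain ⟨a1, -, a3⟩ := key j l (by grind) (by grind)
      obtain ⟨-, b2, -⟩ := key k j (by grind) (by grind)
      exact b2 (le_trans (le_trans (le_inf inf_le_right a1) a3) (h2 k))
    · obtain ⟨a1, -, a3⟩ := key j l (by grind) (by grind)
      obtain ⟨-, b2, -⟩ := key k j (by grind) (by grind)
      exact b2 (le_trans (le_trans (le_inf inf_le_right a1) a3) (h2 k))
  have h5 : ¬ ((k < l ↔ j < k) ∧ (l < k ↔ k < j)) := fun h => by
    obtain ⟨-, b2, -⟩ := key j k h.1 h.2
    exact b2 (hk.trans (h2 j))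
  grind

/-- All cases are clauses of uniformity or indiscernibility of the row itself, except `c s ⊓ q t k ≤
c s'`. That case needs uniformity over `c s ⊓ c s'` as well, through `IsUniform.inf_le_imp`. -/
theorem indiscernibleOver_of_isUniform (hX : IsTree X) (hN : 3 ≤ N) {c : S → X} {q : E → Fin N → X}
    (hq : ∀ (e : Fin 3 → E) (k l : Fin 3 → Fin N), (∀ a b, k a < k b ↔ l a < l b) →
      (q (e 0) (k 0) ⊓ q (e 1) (k 1) ≤ q (e 2) (k 2) ↔
        q (e 0) (l 0) ⊓ q (e 1) (l 1) ≤ q (e 2) (l 2)))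
    (hc : ∀ s s', IsUniform q (c s ⊓ c s')) : IndiscernibleOver c q := by
  have hc' : ∀ s, IsUniform q (c s) := fun s => by simpa using hc s s
  have key : ∀ s s' t k l, c s ⊓ q t k ≤ c s' ↔ c s ⊓ q t l ≤ c s' := by
    intro s s' t k l
    have e : ∀ k, c s ⊓ q t k ≤ c s' ↔ c s ⊓ q t k ≤ c s ⊓ c s' := fun k => by
      rw [le_inf_iff]; simp
    rw [e, e]
    exact ⟨(hc' s).inf_le_imp hX hN (hc s s') inf_le_left t k l,
      (hc' s).inf_le_imp hX hN (hc s s') inf_le_left t l k⟩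
  intro e k l hkl
  obtain ⟨e0, he0⟩ : ∃ e0, e 0 = e0 := ⟨_, rfl⟩
  obtain ⟨e1, he1⟩ : ∃ e1, e 1 = e1 := ⟨_, rfl⟩
  obtain ⟨e2, he2⟩ : ∃ e2, e 2 = e2 := ⟨_, rfl⟩
  rw [he0, he1, he2]
  rcases e0 with s0 | t0 <;> rcases e1 with s1 | t1 <;> rcases e2 with s2 | t2 <;>
    simp only [joinTuple, Sum.elim_inl, Sum.elim_inr]
  · exact (hc s0 s1).le_iff _ _ _
  · exact key _ _ _ _ _
  · exact (hc' s0).inf_le_iff' _ _ _ _ _ _ (hkl 1 2) (hkl 2 1)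
  · rw [inf_comm, inf_comm _ (c s1)]; exact key _ _ _ _ _
  · rw [inf_comm, inf_comm _ (c s1)]
    exact (hc' s1).inf_le_iff' _ _ _ _ _ _ (hkl 0 2) (hkl 2 0)
  · exact (hc' s2).inf_le_iff _ _ _ _ _ _ (hkl 0 1) (hkl 1 0)
  · exact hq ![t0, t1, t2] k l hkl

/-- Among sufficiently many mutually indiscernible rows one is indiscernible over a given tuple. -/
theorem MutuallyIndiscernible.exists_indiscernibleOver {r n : ℕ} {E : Fin r → Type*}
    {pt : (Σ i, E i) → Fin N → X} (hX : IsTree X) (hN : 3 ≤ N) (h : MutuallyIndiscernible pt)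
    (hr : n * n < r) (c : Fin n → X) :
    ∃ i, IndiscernibleOver c (fun t => pt ⟨i, t⟩) := by
  by_contra! hc
  have h1 : ∀ i, ∃ p : Fin n × Fin n, ¬ IsUniform (fun t => pt ⟨i, t⟩) (c p.1 ⊓ c p.2) := by
    intro i
    by_contra! h2
    refine hc i (indiscernibleOver_of_isUniform hX hN (fun e k l hkl => ?_) fun s s' => h2 (s, s'))
    exact h (fun a => ⟨i, e a⟩) k l fun a b _ => hkl a b
  choose f hf using h1
  -- Two rows fail to be uniform over the same one of the `n * n` meets.
  obtain ⟨i, i', hi, he⟩ := Fintype.exists_ne_map_eq_of_card_lt f (by simpa)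
  rcases h.isUniform_or hX hi (c (f i).1 ⊓ c (f i).2) with h3 | h3
  · exact hf i h3
  · rw [he] at h3; exact hf i' h3

end Rows

/-! ### Amalgamating copies over an indiscernible row -/

section Eq

variable {X : Type*} [SemilatticeInf X] {N : ℕ} {S E : Type*} {c : S → X} {q : E → Fin N → X}

theorem IndiscernibleOver.inf_le_inf_iff (h : IndiscernibleOver c q) (e : Fin 4 → S ⊕ E)
    (k l : Fin 4 → Fin N) (hkl : ∀ a b, k a < k b ↔ l a < l b) :
    joinTuple c q (k 0) (e 0) ⊓ joinTuple c q (k 1) (e 1) ≤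
        joinTuple c q (k 2) (e 2) ⊓ joinTuple c q (k 3) (e 3) ↔
      joinTuple c q (l 0) (e 0) ⊓ joinTuple c q (l 1) (e 1) ≤
        joinTuple c q (l 2) (e 2) ⊓ joinTuple c q (l 3) (e 3) := by
  rw [le_inf_iff, le_inf_iff]
  exact and_congr
    (h (fun a => e (![0, 1, 2] a)) (fun a => k (![0, 1, 2] a)) (fun a => l (![0, 1, 2] a))
      fun _ _ => hkl _ _)
    (h (fun a => e (![0, 1, 3] a)) (fun a => k (![0, 1, 3] a)) (fun a => l (![0, 1, 3] a))
      fun _ _ => hkl _ _)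

theorem IndiscernibleOver.inf_eq_inf_iff (h : IndiscernibleOver c q) (e : Fin 4 → S ⊕ E)
    (k l : Fin 4 → Fin N) (hkl : ∀ a b, k a < k b ↔ l a < l b) :
    joinTuple c q (k 0) (e 0) ⊓ joinTuple c q (k 1) (e 1) =
        joinTuple c q (k 2) (e 2) ⊓ joinTuple c q (k 3) (e 3) ↔
      joinTuple c q (l 0) (e 0) ⊓ joinTuple c q (l 1) (e 1) =
        joinTuple c q (l 2) (e 2) ⊓ joinTuple c q (l 3) (e 3) := by
  rw [le_antisymm_iff, le_antisymm_iff]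
  exact and_congr (h.inf_le_inf_iff e k l hkl)
    (h.inf_le_inf_iff (fun a => e (![2, 3, 0, 1] a)) (fun a => k (![2, 3, 0, 1] a))
      (fun a => l (![2, 3, 0, 1] a)) fun _ _ => hkl _ _)

end Eq

/-- Every column of a row which is indiscernible in the full language, and over `c` in the language
of trees, can simultaneously play the role of one middle column relative to `c`. -/
theorem exists_simultaneous_conjugates {K : ℕ} (hK : 2 ≤ K) {S E : Type} [Finite S] [Finite E]
    {c : S → Gen} {q : E → Fin (2 * K) → Gen} (h : IndiscernibleOver c q)
    (hR : ∀ (e : Fin 4 → E) (k l : Fin 4 → Fin (2 * K)), (∀ a b, k a < k b ↔ l a < l b) →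
      (Gen.adj (q (e 0) (k 0) ⊓ q (e 1) (k 1)) (q (e 2) (k 2) ⊓ q (e 3) (k 3)) ↔
        Gen.adj (q (e 0) (l 0) ⊓ q (e 1) (l 1)) (q (e 2) (l 2) ⊓ q (e 3) (l 3)))) :
    ∃ c' : S → Gen, ∀ j : Fin (2 * K), (j : ℕ) < K → ∃ σ : Gen ≃[treeGraph] Gen,
      (∀ s, σ (c s) = c' s) ∧ ∀ t, σ (q t ⟨K, by omega⟩) = q t j := by
  classical
  set b : Fin (2 * K) := ⟨K, by omega⟩ with hb
  have hbv : (b : ℕ) = K := rfl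
  set z : Fin (2 * K) → S ⊕ E → Gen := joinTuple c q with hz
  set J := {j : Fin (2 * K) // (j : ℕ) < K}
  set A : Set Gen := infRange fun p : E × J => q p.1 p.2 with hA
  set B : Set Gen := infRange (Sum.elim c fun p : E × J => q p.1 p.2) with hB
  have hzB : ∀ j : J, ∀ v w, z j v ⊓ z j w ∈ B := by
    intro j v w
    have e : ∀ v, ∃ p, z j v = Sum.elim c (fun p : E × J => q p.1 p.2) p := by
      rintro (s | t)
      · exact ⟨.inl s, rfl⟩
      · exact ⟨.inr (t, j), rfl⟩
    obtain ⟨p, hp⟩ := e v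
    obtain ⟨p', hp'⟩ := e w
    rw [hp, hp']
    exact mem_infRange _ p p'
  have hAB : A ⊆ B := by
    rintro _ ⟨⟨p, p'⟩, rfl⟩
    exact mem_infRange (Sum.elim c fun p : E × J => q p.1 p.2) (.inr p) (.inr p')
  -- equalities between meets transfer to the middle column
  have hα : ∀ j j' : Fin (2 * K), ∀ v v' w w', z j v ⊓ z j v' = z j' w ⊓ z j' w' →
      z b v ⊓ z b v' = z b w ⊓ z b w' := by
    have hmove : ∀ j j' k k' : Fin (2 * K), (j < j' ↔ k < k') → (j' < j ↔ k' < k) →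
        ∀ v v' w w', z j v ⊓ z j v' = z j' w ⊓ z j' w' ↔ z k v ⊓ z k v' = z k' w ⊓ z k' w' := by
      intro j j' k k' h1 h2 v v' w w'
      refine h.inf_eq_inf_iff ![v, v', w, w'] ![j, j, j', j'] ![k, k, k', k'] fun a b => ?_
      fin_cases a <;> fin_cases b <;> simp [h1, h2]
    have hlt : ∀ j j' : Fin (2 * K), j < j' → ∀ v v' w w', z j v ⊓ z j v' = z j' w ⊓ z j' w' →
        z b v ⊓ z b v' = z b w ⊓ z b w' := by
      intro j j' hjj v v' w w' heq
      -- Three columns `o < b < m` are compared: the equality holds for the pairs `(o, b)`, `(o, m)`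
      -- and `(b, m)`, and chaining these gives the equality inside column `b`.
      set o : Fin (2 * K) := ⟨0, by omega⟩
      set m : Fin (2 * K) := ⟨K + 1, by omega⟩
      have hob : o < b := Fin.lt_def.2 (by simp [o, b]; omega)
      have hbm : b < m := Fin.lt_def.2 (by simp [m, b])
      have hom := hob.trans hbm
      have h1 := (hmove j j' o b (iff_of_true hjj hob) (iff_of_false hjj.not_gt hob.not_gt) v v' w w').1 heq
      have h2 := (hmove j j' o m (iff_of_true hjj hom) (iff_of_false hjj.not_gt hom.not_gt) v v' w w').1 heq
      have h3 := (hmove j j' b m (iff_of_true hjj hbm) (iff_of_false hjj.not_gt hbm.not_gt) v v' w w').1 heq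
      rw [h3, ← h2, h1]
    intro j j' v v' w w' heq
    rcases lt_trichotomy j j' with hjj | rfl | hjj
    · exact hlt j j' hjj v v' w w' heq
    · exact (hmove j j b b (by simp) (by simp) v v' w w').1 heq
    · exact (hlt j' j hjj w w' v v' heq.symm).symm
  -- on the row itself the graph agrees with that of the middle column
  have hβ : ∀ j : J, ∀ v v' w w', z j v ⊓ z j v' ∈ A → z j w ⊓ z j w' ∈ A →
      (Gen.adj (z b v ⊓ z b v') (z b w ⊓ z b w') ↔
        Gen.adj (z j v ⊓ z j v') (z j w ⊓ z j w')) := by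
    rintro ⟨j, hj⟩ v v' w w' ⟨⟨⟨t₁, k₁, hk₁⟩, t₂, k₂, hk₂⟩, h1⟩ ⟨⟨⟨t₃, k₃, hk₃⟩, t₄, k₄, hk₄⟩, h2⟩
    simp only at h1 h2 ⊢
    -- The shift by `K - j` takes column `j` to the middle column and preserves the order of the
    -- first `K` columns; this is why the row has `2 * K` columns. Its values elsewhere play no
    -- role.
    set sh : Fin (2 * K) → Fin (2 * K) := fun k =>
      if hk : (k : ℕ) < K then ⟨k + (K - j), by omega⟩ else k with hsh
    have hshv : ∀ k : Fin (2 * K), (k : ℕ) < K → ((sh k : Fin (2 * K)) : ℕ) = k + (K - j) :=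
      fun k hk => by simp [hsh, hk]
    have hshj : sh j = b := Fin.ext (by rw [hshv j hj, hbv]; omega)
    have hshlt : ∀ k k' : Fin (2 * K), (k : ℕ) < K → (k' : ℕ) < K → (k < k' ↔ sh k < sh k') := by
      intro k k' hk hk'
      rw [Fin.lt_def, Fin.lt_def, hshv k hk, hshv k' hk']; omega
    have hmove : ∀ v v' t t' k k', k.1 < K → k'.1 < K → q t k ⊓ q t' k' = z j v ⊓ z j v' →
        z b v ⊓ z b v' = q t (sh k) ⊓ q t' (sh k') := by
      intro v v' t t' k k' hk hk' heq
      rw [← hshj]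
      refine (h.inf_eq_inf_iff ![v, v', .inr t, .inr t'] ![j, j, k, k']
        ![sh j, sh j, sh k, sh k'] fun a b => ?_).1 heq.symm
      fin_cases a <;> fin_cases b <;> simp [hshlt, hj, hk, hk']
    rw [hmove v v' t₁ t₂ k₁ k₂ hk₁ hk₂ h1, hmove w w' t₃ t₄ k₃ k₄ hk₃ hk₄ h2, ← h1, ← h2]
    refine (hR ![t₁, t₂, t₃, t₄] ![k₁, k₂, k₃, k₄] ![sh k₁, sh k₂, sh k₃, sh k₄] fun a b => ?_).symm
    fin_cases a <;> fin_cases b <;> simp [hshlt, hk₁, hk₂, hk₃, hk₄]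
  -- The new graph keeps the old one on the row and copies onto `c` with column `j` the graph of `c`
  -- with the middle column. The prescriptions agree on overlaps by `hα` and `hβ`.
  set R : Gen → Gen → Prop := fun x y => (x ∈ A ∧ y ∈ A ∧ Gen.adj x y) ∨
    ∃ j : J, ∃ v v' w w', x = z j v ⊓ z j v' ∧ y = z j w ⊓ z j w' ∧
      Gen.adj (z b v ⊓ z b v') (z b w ⊓ z b w') with hRdef
  have hRs : ∀ x y, R x y → R y x := by
    rintro x y (⟨hx, hy, hxy⟩ | ⟨j, v, v', w, w', hx, hy, hxy⟩)
    · exact .inl ⟨hy, hx, Gen.adj_symm hxy⟩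
    · exact .inr ⟨j, w, w', v, v', hy, hx, Gen.adj_symm hxy⟩
  have hRi : ∀ x, ¬ R x x := by
    rintro x (⟨hx, hy, hxy⟩ | ⟨j, v, v', w, w', hx, hy, hxy⟩)
    · exact Gen.adj_irrefl _ hxy
    · rw [hα j j v v' w w' (hx.symm.trans hy)] at hxy
      exact Gen.adj_irrefl _ hxy
  have hRA : ∀ x ∈ A, ∀ y ∈ A, (Gen.adj x y ↔ R x y) := by
    intro x hx y hy
    refine ⟨fun hxy => .inl ⟨hx, hy, hxy⟩, ?_⟩
    rintro (⟨_, _, hxy⟩ | ⟨j, v, v', w, w', rfl, rfl, hxy⟩)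
    · exact hxy
    · exact (hβ j v v' w w' hx hy).1 hxy
  have hRB : ∀ j : J, ∀ v v' w w', R (z j v ⊓ z j v') (z j w ⊓ z j w') ↔
      Gen.adj (z b v ⊓ z b v') (z b w ⊓ z b w') := by
    intro j v v' w w'
    refine ⟨?_, fun hxy => .inr ⟨j, v, v', w, w', rfl, rfl, hxy⟩⟩
    rintro (⟨hx, hy, hxy⟩ | ⟨j', p, p', r, r', h1, h2, hxy⟩)
    · exact (hβ j v v' w w' hx hy).2 hxy
    · rw [hα j j' v v' p p' h1, hα j j' w w' r r' h2]
      exact hxy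
  have hAfin : A.Finite := finite_infRange _
  have hBfin : B.Finite := finite_infRange _
  -- The identity on the row respects `R`. Its extension to `B` moves `c` to a tuple with the same
  -- tree position over the row and the new graph relations.
  have h0 : PartialIso R hAfin.toFinset id :=
    ⟨fun _ _ _ _ => Iff.rfl, fun _ _ _ _ => rfl, fun x hx y hy =>
      hRA x (by simpa using hx) y (by simpa using hy)⟩
  obtain ⟨g, hgA, hg⟩ := h0.exists_extend (B := hBfin.toFinset) Gen.isTree hRs hRi
    (by simpa using Gen.isTree.infClosed_infRange _) (by simpa using hAB)
    (by simpa using Gen.isTree.infClosed_infRange _)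
  have hgA' : ∀ x ∈ A, g x = x := fun x hx => hgA x (by simpa using hx)
  have hginf : ∀ x ∈ B, ∀ y ∈ B, g (x ⊓ y) = g x ⊓ g y := fun x hx y hy =>
    hg.map_inf x (by simpa using hx) y (by simpa using hy)
  have hgle : ∀ x ∈ B, ∀ y ∈ B, (g x ≤ g y ↔ x ≤ y) := fun x hx y hy =>
    hg.le_iff x (by simpa using hx) y (by simpa using hy)
  have hgadj : ∀ x ∈ B, ∀ y ∈ B, (Gen.adj (g x) (g y) ↔ R x y) := fun x hx y hy =>
    hg.adj_iff x (by simpa using hx) y (by simpa using hy)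
  refine ⟨fun s => g (c s), fun j hj => ?_⟩
  have hzB' : ∀ v, z j v ∈ B := fun v => by simpa using hzB ⟨j, hj⟩ v v
  obtain ⟨σ, hσ⟩ := Gen.exists_equiv_of_forall_iff (z b) (fun v => g (z j v))
    (fun v v' w => by
      rw [← hginf _ (hzB' v) _ (hzB' v'), hgle _ (hzB ⟨j, hj⟩ v v') _ (hzB' w)]
      exact h ![v, v', w] (fun _ => b) (fun _ => j) fun _ _ => by simp)
    (fun v v' w w' => by
      rw [← hginf _ (hzB' v) _ (hzB' v'), ← hginf _ (hzB' w) _ (hzB' w'),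
        hgadj _ (hzB ⟨j, hj⟩ v v') _ (hzB ⟨j, hj⟩ w w')]
      exact (hRB ⟨j, hj⟩ v v' w w').symm)
  refine ⟨σ, fun s => hσ (.inl s), fun t => (hσ (.inr t)).trans (hgA' _ ?_)⟩
  exact mem_infRange_self (fun p : E × J => q p.1 p.2) (t, ⟨j, hj⟩)

/-- There is no array in the generic structure with more than `n ^ 2` rows in which all paths are
consistent and all rows are inconsistent, provided that the rows are mutually indiscernible. -/
theorem Gen.exists_realize_row {n r K : ℕ} (hK : 2 ≤ K) (hr : n * n < r) {l : Fin r → ℕ}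
    (φ : ∀ i, treeGraph.Formula (Fin n ⊕ Fin (l i))) (pt : (Σ i, Fin (l i)) → Fin (2 * K) → Gen)
    (hpt : MutuallyIndiscernible pt)
    (hR : ∀ i (e : Fin 4 → Fin (l i)) (k m : Fin 4 → Fin (2 * K)), (∀ a b, k a < k b ↔ m a < m b) →
      (Gen.adj (pt ⟨i, e 0⟩ (k 0) ⊓ pt ⟨i, e 1⟩ (k 1)) (pt ⟨i, e 2⟩ (k 2) ⊓ pt ⟨i, e 3⟩ (k 3)) ↔
        Gen.adj (pt ⟨i, e 0⟩ (m 0) ⊓ pt ⟨i, e 1⟩ (m 1))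
          (pt ⟨i, e 2⟩ (m 2) ⊓ pt ⟨i, e 3⟩ (m 3))))
    (c : Fin n → Gen)
    (hc : ∀ i, (φ i).Realize (Sum.elim c fun t => pt ⟨i, t⟩ ⟨K, by omega⟩)) :
    ∃ i, ∃ c' : Fin n → Gen, ∀ j : Fin (2 * K), (j : ℕ) < K →
      (φ i).Realize (Sum.elim c' fun t => pt ⟨i, t⟩ j) := by
  obtain ⟨i, hi⟩ := hpt.exists_indiscernibleOver Gen.isTree (by omega) hr c
  obtain ⟨c', hc'⟩ := exists_simultaneous_conjugates hK hi (hR i)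
  refine ⟨i, c', fun j hj => ?_⟩
  obtain ⟨σ, h1, h2⟩ := hc' j hj
  have := (StrongHomClass.realize_formula σ (φ i)).2 (hc i)
  convert! this using 1
  ext (s | t)
  · exact (h1 s).symm
  · exact (h2 t).symm

/-! ### Transfer to arbitrary models -/

section Transfer

theorem realize_of_realize_completeTheory {L : FirstOrder.Language.{0, 0}} {A : Type*}
    [L.Structure A] {M : Type*} [L.Structure M] [M ⊨ L.completeTheory A] {σ : L.Sentence}
    (h : M ⊨ σ) : A ⊨ σ := by
  by_contra h'
  have h1 : σ.not ∈ L.completeTheory A := (Sentence.realize_not A).2 h'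
  exact (Sentence.realize_not M).1 (Theory.realize_sentence_of_mem (L.completeTheory A) h1) h

/-- Finitely many formulas true or false of a finite tuple in a model of the complete theory of `A`
are simultaneously true or false of a tuple in `A`. -/
theorem exists_realize_iff {L : FirstOrder.Language.{0, 0}} {A : Type*} [L.Structure A]
    {M : Type*} [L.Structure M] [M ⊨ L.completeTheory A] {W κ : Type} [Finite W] [Finite κ]
    (ψ : κ → L.Formula W) (a : W → M) :
    ∃ a' : W → A, ∀ k, (ψ k).Realize a ↔ (ψ k).Realize a' := by
  classical
  set θ : L.Formula W := BoundedFormula.iInf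
    fun k => if (ψ k).Realize a then ψ k else (ψ k).not with hθ
  have h1 : M ⊨ (Formula.iExs W (θ.relabel (Sum.inr : W → Empty ⊕ W)) : L.Sentence) := by
    rw [Sentence.Realize, Formula.realize_iExs]
    refine ⟨a, ?_⟩
    rw [Formula.realize_relabel, hθ, Formula.Realize, BoundedFormula.realize_iInf]
    intro k
    by_cases h : (ψ k).Realize a
    · simp only [h, if_true]; exact h
    · simp only [h, if_false]; exact h
  have h2 := realize_of_realize_completeTheory (A := A) h1
  rw [Sentence.Realize, Formula.realize_iExs] at h2
  obtain ⟨a', ha'⟩ := h2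
  rw [Formula.realize_relabel, hθ, Formula.Realize, BoundedFormula.realize_iInf] at ha'
  refine ⟨a', fun k => ?_⟩
  have := ha' k
  by_cases h : (ψ k).Realize a
  · simp only [h, if_true] at this; exact iff_of_true h this
  · simp only [h, if_false] at this; exact iff_of_false h this

/-- The formula `∃ x, ⋀ᵢ θᵢ(x)`. -/
def exConj {L : FirstOrder.Language.{0, 0}} {W ι : Type} [Finite ι] {n : ℕ}
    (θ : ι → L.Formula (W ⊕ Fin n)) : L.Formula W :=
  Formula.iExs (Fin n) (BoundedFormula.iInf θ : L.Formula (W ⊕ Fin n))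

theorem realize_exConj {L : FirstOrder.Language.{0, 0}} {W ι : Type} [Finite ι] {n : ℕ}
    (θ : ι → L.Formula (W ⊕ Fin n)) {M : Type*} [L.Structure M] (v : W → M) :
    (exConj θ).Realize v ↔ ∃ c : Fin n → M, ∀ i, (θ i).Realize (Sum.elim v c) := by
  rw [exConj, Formula.realize_iExs]
  refine exists_congr fun c => ?_
  rw [Formula.Realize, BoundedFormula.realize_iInf]
  rfl

/-- The term `t ∧ t'`. -/
def meetTerm {α : Type*} (t t' : treeGraph.Term α) : treeGraph.Term α :=
  Term.func (l := 2) TreeGraphFunctions.meet ![t, t']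

theorem realize_meetTerm {α : Type*} {M : Type*} [treeGraph.Structure M] (t t' : treeGraph.Term α)
    (v : α → M) : (meetTerm t t').realize v = tmeet (t.realize v) (t'.realize v) :=
  funMap_meet _

/-- The formula `t ⊴ t'`. -/
def leFormula {α : Type*} (t t' : treeGraph.Term α) : treeGraph.Formula α :=
  Relations.formula (n := 2) (TreeGraphRelations.le : treeGraph.Relations 2) ![t, t']

theorem realize_leFormula {α : Type*} {M : Type*} [treeGraph.Structure M] (t t' : treeGraph.Term α)
    (v : α → M) : (leFormula t t').Realize v ↔ tle (t.realize v) (t'.realize v) :=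
  Formula.realize_rel.trans (relMap_le _)

/-- The formula `R(t, t')`. -/
def adjFormula {α : Type*} (t t' : treeGraph.Term α) : treeGraph.Formula α :=
  Relations.formula (n := 2) (TreeGraphRelations.adj : treeGraph.Relations 2) ![t, t']

theorem realize_adjFormula {α : Type*} {M : Type*} [treeGraph.Structure M]
    (t t' : treeGraph.Term α) (v : α → M) :
    (adjFormula t t').Realize v ↔ tadj (t.realize v) (t'.realize v) :=
  Formula.realize_rel.trans (relMap_adj _)

end Transfer

/-! ### Absence of inp-patterns -/

theorem realize_inst {L : FirstOrder.Language.{0, 0}} {M N : Type*} [L.Structure N] {n l : ℕ}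
    (φ : L.Formula (Fin n ⊕ Fin l)) (a : Fin l → M) (f : M → N) (c : Fin n → N) :
    (inst φ a).Realize (Sum.elim f c) ↔ φ.Realize (Sum.elim c fun t => f (a t)) := by
  rw [inst, Formula.realize_relabel]
  apply iff_of_eq
  congr 1
  ext (s | t) <;> rfl

theorem consistent_of_realize {L : FirstOrder.Language.{0, 0}} {M : Type u} [L.Structure M] {n : ℕ}
    {Γ : Set (L.Formula (M ⊕ Fin n))} (c : Fin n → M)
    (h : ∀ ψ ∈ Γ, ψ.Realize (Sum.elim id c)) : Consistent Γ :=
  ⟨M, inferInstance, ElementaryEmbedding.refl L M, c, h⟩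

theorem Consistent.mono {L : FirstOrder.Language.{0, 0}} {M : Type u} [L.Structure M] {n : ℕ}
    {Γ Δ : Set (L.Formula (M ⊕ Fin n))} (h : Consistent Δ) (hΓ : Γ ⊆ Δ) : Consistent Γ := by
  obtain ⟨N, _, f, c, hc⟩ := h
  exact ⟨N, _, f, c, fun ψ hψ => hc ψ (hΓ hψ)⟩

/-- The order is lexicographic, so the rows can occupy successive blocks of one homogeneous
sequence. Comparisons between different rows are then fixed, and homogeneity becomes mutual
indiscernibility. -/
theorem finProdFinEquiv_lt_iff {r m : ℕ} (i i' : Fin r) (k k' : Fin m) :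
    finProdFinEquiv (i, k) < finProdFinEquiv (i', k') ↔ i < i' ∨ i = i' ∧ k < k' := by
  rw [Fin.lt_def, Fin.lt_def, Fin.lt_def, Fin.ext_iff]
  simp only [finProdFinEquiv_apply_val]
  have hk := k.2
  have hk' := k'.2
  constructor
  · intro h
    by_contra! h'
    rcases h'.1.lt_or_eq with h1 | h1
    · have : m * ((i' : ℕ) + 1) ≤ m * i := Nat.mul_le_mul_left _ h1
      rw [Nat.mul_add] at this
      omega
    · have := h'.2 h1.symm
      rw [h1] at h
      omega
  · rintro (h | ⟨h, h'⟩)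
    · have : m * ((i : ℕ) + 1) ≤ m * i' := Nat.mul_le_mul_left _ h
      rw [Nat.mul_add] at this
      omega
    · rw [h]; omega

/-- Modulo the theory of the generic structure there is no inp-pattern in `n` variables with more
than `n ^ 2` rows. -/
theorem not_hasInpPattern {n r : ℕ} (hr : n * n < r) :
    ¬ HasInpPattern.{u} (treeGraph.completeTheory Gen) n (Fin r) := by
  classical
  rintro ⟨M, l, φ, a, k, hpath, hrow⟩
  obtain ⟨K, hK, hkK⟩ : ∃ K, 2 ≤ K ∧ ∀ i, k i ≤ K :=
    ⟨Finset.univ.sup k + 2, by omega, fun i =>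
      (Finset.le_sup (f := k) (Finset.mem_univ i)).trans (by omega)⟩
  set D := Σ i, Fin (l i)
  set X : D → ℕ → M := fun d j => a d.1 j d.2
  obtain ⟨j, hj, hhom⟩ := exists_strictMono_homogeneous
    (fun (y : Fin 4 → ℕ) (e : Fin 4 → D) =>
      ((tle (tmeet (X (e 0) (y 0)) (X (e 1) (y 1))) (X (e 2) (y 2)) : Prop),
        (tadj (tmeet (X (e 0) (y 0)) (X (e 1) (y 1)))
          (tmeet (X (e 2) (y 2)) (X (e 3) (y 3))) : Prop))) (r * (2 * K))
  set W := D × Fin (2 * K)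
  set col : Fin r → Fin (2 * K) → ℕ := fun i k => j (finProdFinEquiv (i, k)) with hcol
  set v : W → M := fun w => X w.1 (col w.1.1 w.2) with hv
  have hQM : ∀ (e : Fin 4 → D) (p q : Fin 4 → Fin (2 * K)),
      (∀ a b, (e a).1 = (e b).1 → (p a < p b ↔ q a < q b)) →
      (tle (tmeet (v (e 0, p 0)) (v (e 1, p 1))) (v (e 2, p 2)) ↔
        tle (tmeet (v (e 0, q 0)) (v (e 1, q 1))) (v (e 2, q 2))) ∧
      (tadj (tmeet (v (e 0, p 0)) (v (e 1, p 1))) (tmeet (v (e 2, p 2)) (v (e 3, p 3))) ↔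
        tadj (tmeet (v (e 0, q 0)) (v (e 1, q 1))) (tmeet (v (e 2, q 2)) (v (e 3, q 3)))) := by
    intro e p q hpq
    have := congrFun (hhom (fun a => finProdFinEquiv ((e a).1, p a))
      (fun a => finProdFinEquiv ((e a).1, q a)) fun a b => by
        rw [finProdFinEquiv_lt_iff, finProdFinEquiv_lt_iff]
        have := hpq a b
        tauto) e
    simp only [Prod.mk.injEq, eq_iff_iff] at this
    exact this
  set b : Fin (2 * K) := ⟨K, by omega⟩
  set sub : ∀ i, Fin (2 * K) → treeGraph.Formula (W ⊕ Fin n) := fun i k =>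
    (φ i).relabel (Sum.elim Sum.inr fun t => Sum.inl (⟨i, t⟩, k)) with hsub
  have hsubr : ∀ (i : Fin r) (k : Fin (2 * K)) (B : Type u) [treeGraph.Structure B] (w : W → B)
      (c : Fin n → B), (sub i k).Realize (Sum.elim w c) ↔
        (φ i).Realize (Sum.elim c fun t => w (⟨i, t⟩, k)) := by
    intro i k B _ w c
    rw [hsub, Formula.realize_relabel]
    apply iff_of_eq
    congr 1
    ext (s | t) <;> rfl
  have hsubg : ∀ (i : Fin r) (k : Fin (2 * K)) (w : W → Gen)
      (c : Fin n → Gen), (sub i k).Realize (Sum.elim w c) ↔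
        (φ i).Realize (Sum.elim c fun t => w (⟨i, t⟩, k)) := by
    intro i k w c
    rw [hsub, Formula.realize_relabel]
    apply iff_of_eq
    congr 1
    ext (s | t) <;> rfl
  -- What is transferred to `Gen`: the path through the middle columns is realized (`ψ₀`), the first
  -- `k i` columns of row `i` are not realized together (the negation of `ψ₁`), and the order and
  -- graph relations between meets are kept (`ψ₂`, `ψ₃`).
  set ψ₀ : treeGraph.Formula W := exConj fun i => sub i b with hψ₀
  set ψ₁ : Fin r → treeGraph.Formula W := fun i =>
    exConj fun m : Fin (k i) => sub i ⟨m, by have := hkK i; omega⟩ with hψ₁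
  set x : W → treeGraph.Term W := fun w => Term.var w
  set ψ₂ : (Fin 3 → W) → treeGraph.Formula W := fun w =>
    leFormula (meetTerm (x (w 0)) (x (w 1))) (x (w 2)) with hψ₂
  set ψ₃ : (Fin 4 → W) → treeGraph.Formula W := fun w =>
    adjFormula (meetTerm (x (w 0)) (x (w 1))) (meetTerm (x (w 2)) (x (w 3))) with hψ₃
  obtain ⟨v', hv'⟩ := exists_realize_iff (A := Gen) (M := M)
    (Sum.elim (Sum.elim (fun _ : Unit => ψ₀) ψ₁) (Sum.elim ψ₂ ψ₃)) v
  have h₀ : ψ₀.Realize v := by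
    obtain ⟨N, _, f, c, hc⟩ := hpath fun i => col i b
    rw [← f.map_formula, realize_exConj]
    refine ⟨c, fun i => (hsubr i b N _ c).2 ?_⟩
    exact (realize_inst (φ i) (a i (col i b)) f c).1 (hc _ ⟨i, rfl⟩)
  have h₁ : ∀ i, ¬ (ψ₁ i).Realize v := by
    intro i h
    obtain ⟨c, hc⟩ := (realize_exConj _ _).1 h
    refine hrow i (Finset.univ.image fun m : Fin (k i) =>
      col i ⟨m, by have := hkK i; omega⟩) ?_ (consistent_of_realize c ?_)
    · rw [Finset.card_image_of_injective, Finset.card_univ, Fintype.card_fin]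
      intro m m' hmm
      have h1 := finProdFinEquiv.injective (hj.injective hmm)
      have h2 := congrArg (fun p : Fin r × Fin (2 * K) => (p.2 : ℕ)) h1
      exact Fin.ext h2
    · rintro ψ ⟨p, hp, rfl⟩
      obtain ⟨m, -, rfl⟩ := Finset.mem_image.1 hp
      exact (realize_inst _ _ id c).2 ((hsubr i _ M _ c).1 (hc m))
  have h₂ : ∀ w : Fin 3 → W, tle (tmeet (v (w 0)) (v (w 1))) (v (w 2)) ↔
      v' (w 0) ⊓ v' (w 1) ≤ v' (w 2) := by
    intro w
    have := hv' (.inr (.inl w))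
    simp only [Sum.elim_inr, Sum.elim_inl, hψ₂, realize_leFormula, realize_meetTerm] at this
    exact this
  have h₃ : ∀ w : Fin 4 → W, tadj (tmeet (v (w 0)) (v (w 1))) (tmeet (v (w 2)) (v (w 3))) ↔
      Gen.adj (v' (w 0) ⊓ v' (w 1)) (v' (w 2) ⊓ v' (w 3)) := by
    intro w
    have := hv' (.inr (.inr w))
    simp only [Sum.elim_inr, hψ₃, realize_adjFormula, realize_meetTerm] at this
    exact this
  obtain ⟨c, hc⟩ := (realize_exConj _ _).1 ((hv' (.inl (.inl ()))).1 h₀)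
  obtain ⟨i, c', hc'⟩ := Gen.exists_realize_row hK hr φ (fun d k => v' (d, k))
    (fun d p q hpq => by
      have h4 := (hQM (fun a => d (![0, 1, 2, 2] a)) (fun a => p (![0, 1, 2, 2] a))
        (fun a => q (![0, 1, 2, 2] a)) fun _ _ => hpq _ _).1
      exact (h₂ fun a => (d a, p a)).symm.trans (h4.trans (h₂ fun a => (d a, q a))))
    (fun i e p q hpq => by
      have h4 := (hQM (fun a => ⟨i, e a⟩) p q fun a b _ => hpq a b).2
      exact (h₃ fun a => (⟨i, e a⟩, p a)).symm.trans (h4.trans (h₃ fun a => (⟨i, e a⟩, q a))))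
    c (fun i => (hsubg i b v' c).1 (hc i))
  refine h₁ i ((hv' (.inl (.inr i))).2 ((realize_exConj _ _).2 ⟨c', fun m => ?_⟩))
  exact (hsubg i _ v' c').2 (hc' _ (lt_of_lt_of_le m.2 (hkK i)))

theorem isInpMinimal_gen : IsInpMinimal.{u} (treeGraph.completeTheory Gen) :=
  not_hasInpPattern (by norm_num)

/-- The first `n * n + 1` rows of a `TP₂` array form an inp-pattern with one formula repeated. -/
theorem isNTP2_gen : IsNTP2.{u} (treeGraph.completeTheory Gen) := by
  rintro n l φ ⟨M, a, k, hpath, hrow⟩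
  refine not_hasInpPattern.{u} (n := n) (r := n * n + 1) (by omega)
    ⟨M, fun _ => l, fun _ => φ, fun i => a i, fun _ => k, fun f => ?_, fun i => hrow i⟩
  refine (hpath fun i => if h : i < n * n + 1 then f ⟨i, h⟩ else 0).mono ?_
  rintro ψ ⟨i, rfl⟩
  exact ⟨i, by rw [dif_pos i.2]⟩

/-! ### Combs -/

/-- `E < G` and the elements `b t`, for `t ∈ T`, form a comb over `F`: no element of `F` is above
the stem `E`, the teeth `b t` pairwise meet in the fork `G` above `E`, and the graph on the teeth is
trivial except that the stem is adjacent to the teeth of sign `true`. -/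
structure IsComb {τ : Type*} (F : Set Gen) (E G : Gen) (T : Set τ) (s : τ → Bool) (b : τ → Gen) :
    Prop where
  not_le : ∀ z ∈ F, ¬ E ≤ z
  lt : E < G
  lt_tooth : ∀ t ∈ T, G < b t
  inf_eq : ∀ t ∈ T, ∀ t' ∈ T, t ≠ t' → b t ⊓ b t' = G
  not_adj : ∀ t ∈ T, ∀ z ∈ F, ¬ Gen.adj (b t) z ∧ ¬ Gen.adj (b t) (z ⊓ E)
  not_adj_tooth : ∀ t ∈ T, ∀ t' ∈ T, ¬ Gen.adj (b t) (b t')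
  not_adj_fork : ∀ t ∈ T, ¬ Gen.adj (b t) G
  adj_stem : ∀ t ∈ T, (Gen.adj (b t) E ↔ s t = true)

theorem IsComb.mono {τ : Type*} {F F' : Set Gen} {E G : Gen} {T T' : Set τ} {s : τ → Bool}
    {b : τ → Gen} (h : IsComb F E G T s b) (hF : F' ⊆ F) (hT : T' ⊆ T) : IsComb F' E G T' s b where
  not_le z hz := h.not_le z (hF hz)
  lt := h.lt
  lt_tooth t ht := h.lt_tooth t (hT ht)
  inf_eq t ht t' ht' := h.inf_eq t (hT ht) t' (hT ht')
  not_adj t ht z hz := h.not_adj t (hT ht) z (hF hz)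
  not_adj_tooth t ht t' ht' := h.not_adj_tooth t (hT ht) t' (hT ht')
  not_adj_fork t ht := h.not_adj_fork t (hT ht)
  adj_stem t ht := h.adj_stem t (hT ht)

theorem IsComb.congr {τ : Type*} {F : Set Gen} {E G : Gen} {T : Set τ} {s : τ → Bool}
    {b b' : τ → Gen} (h : IsComb F E G T s b) (hb : ∀ t ∈ T, b' t = b t) :
    IsComb F E G T s b' where
  not_le := h.not_le
  lt := h.lt
  lt_tooth t ht := by rw [hb t ht]; exact h.lt_tooth t ht
  inf_eq t ht t' ht' := by rw [hb t ht, hb t' ht']; exact h.inf_eq t ht t' ht'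
  not_adj t ht := by rw [hb t ht]; exact h.not_adj t ht
  not_adj_tooth t ht t' ht' := by rw [hb t ht, hb t' ht']; exact h.not_adj_tooth t ht t' ht'
  not_adj_fork t ht := by rw [hb t ht]; exact h.not_adj_fork t ht
  adj_stem t ht := by rw [hb t ht]; exact h.adj_stem t ht

/-- Above any element there are arbitrarily large finite combs over any finite set. -/
theorem exists_isComb {τ : Type*} (F : Finset Gen) (d : Gen) (T : Finset τ) (s : τ → Bool) :
    ∃ E G : Gen, ∃ b : τ → Gen, d < E ∧ (∀ z ∈ F, z ⊓ E ≤ d) ∧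
      IsComb (F : Set Gen) E G (T : Set τ) s b := by
  classical
  obtain ⟨E, -, hdE, hE⟩ := Gen.exists_leaf F d ∅
  obtain ⟨G, -, hEG, -⟩ := Gen.exists_leaf ∅ E ∅
  have hFE : ∀ z ∈ F, z ≠ E ∧ z ⊓ E ≠ E := fun z hz =>
    ⟨fun h => (hE z hz).2.1 h.ge, fun h => (hE z hz).2.1 (inf_eq_right.1 h)⟩
  suffices h : ∃ b : τ → Gen, IsComb (F : Set Gen) E G (T : Set τ) s b by
    obtain ⟨b, hb⟩ := h
    exact ⟨E, G, b, hdE, fun z hz => by rw [inf_comm]; exact (hE z hz).2.2.1, hb⟩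
  induction T using Finset.induction_on with
  | empty =>
    refine ⟨fun _ => G, fun z hz => (hE z hz).2.1, hEG, ?_, ?_, ?_, ?_, ?_, ?_⟩ <;> simp
  | insert t T ht ih =>
    obtain ⟨b, hb⟩ := ih
    -- The new tooth is a leaf over `G` whose only possible neighbour among the listed elements is
    -- `E`, as its sign prescribes.
    obtain ⟨y, -, hGy, hy⟩ := Gen.exists_leaf
      (F ∪ F.image (· ⊓ E) ∪ {E, G} ∪ T.image b) G {x | x = E ∧ s t = true}
    have hyF : ∀ z ∈ F, ¬ Gen.adj y z ∧ ¬ Gen.adj y (z ⊓ E) := fun z hz =>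
      ⟨fun h => (hFE z hz).1 ((hy z (by simp [hz])).2.2.2.1 h).1,
        fun h => (hFE z hz).2 ((hy (z ⊓ E) (by
          simp only [Finset.mem_union, Finset.mem_image]
          exact .inl (.inl (.inr ⟨z, hz, rfl⟩)))).2.2.2.1 h).1⟩
    have hyT : ∀ t' ∈ T, y ⊓ b t' = G ∧ ¬ Gen.adj y (b t') := fun t' ht' => by
      have h := hy (b t') (by
        simp only [Finset.mem_union, Finset.mem_image]; exact .inr ⟨t', ht', rfl⟩)
      have h' := hb.lt_tooth t' ht'
      exact ⟨le_antisymm h.2.2.1 (le_inf hGy.le h'.le), fun ha =>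
        (hEG.trans h').ne' (h.2.2.2.1 ha).1⟩
    have hyG : ¬ Gen.adj y G := fun h => hEG.ne' ((hy G (by simp)).2.2.2.1 h).1
    have hyE : Gen.adj y E ↔ s t = true := (hy E (by simp)).2.2.2.trans (by simp)
    have hupd : ∀ t' ∈ T, Function.update b t y t' = b t' := fun t' ht' =>
      Function.update_of_ne (fun h : t' = t => ht (h ▸ ht')) _ _
    have hb' := hb.congr hupd
    have hself : Function.update b t y t = y := Function.update_self ..
    have hor : ∀ t' ∈ ((insert t T : Finset τ) : Set τ), t' = t ∨ t' ∈ T := fun t' h => by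
      simpa using h
    refine ⟨Function.update b t y, hb.not_le, hEG, ?_, ?_, ?_, ?_, ?_, ?_⟩
    · intro t' ht'
      rcases hor t' ht' with rfl | h
      · rwa [hself]
      · exact hb'.lt_tooth t' h
    · intro t₁ ht₁ t₂ ht₂ hne
      rcases hor t₁ ht₁ with rfl | h₁ <;> rcases hor t₂ ht₂ with rfl | h₂
      · exact absurd rfl hne
      · rw [hself, hupd t₂ h₂]; exact (hyT t₂ h₂).1
      · rw [hself, hupd t₁ h₁, inf_comm]; exact (hyT t₁ h₁).1
      · exact hb'.inf_eq t₁ h₁ t₂ h₂ hne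
    · intro t' ht'
      rcases hor t' ht' with rfl | h
      · rw [hself]; exact fun z hz => hyF z hz
      · exact hb'.not_adj t' h
    · intro t₁ ht₁ t₂ ht₂
      rcases hor t₁ ht₁ with rfl | h₁ <;> rcases hor t₂ ht₂ with rfl | h₂
      · exact Gen.adj_irrefl _
      · rw [hself, hupd t₂ h₂]; exact (hyT t₂ h₂).2
      · rw [hself, hupd t₁ h₁]; exact fun h => (hyT t₁ h₁).2 (Gen.adj_symm h)
      · exact hb'.not_adj_tooth t₁ h₁ t₂ h₂
    · intro t' ht'
      rcases hor t' ht' with rfl | h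
      · rwa [hself]
      · exact hb'.not_adj_fork t' h
    · intro t' ht'
      rcases hor t' ht' with rfl | h
      · rwa [hself]
      · exact hb'.adj_stem t' h

/-- The teeth of a comb over `F` are indiscernible over a subset of `F`. -/
theorem IsComb.realize_iff {τ α β : Type*} [Finite α] [Finite β] {F : Set Gen} {E G : Gen}
    {T : Set τ} {s : τ → Bool} {b : τ → Gen} (h : IsComb F E G T s b) (f : α → Gen)
    (hf : ∀ a a', f a ⊓ f a' ∈ F) {e e' : β → τ} (he : ∀ x, e x ∈ T) (he' : ∀ x, e' x ∈ T)
    (hi : ∀ x y, e x = e y ↔ e' x = e' y) (φ : treeGraph.Formula (α ⊕ β)) :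
    φ.Realize (Sum.elim f (b ∘ e)) ↔ φ.Realize (Sum.elim f (b ∘ e')) := by
  have hEb : ∀ t ∈ T, E < b t := fun t ht => h.lt.trans (h.lt_tooth t ht)
  have hfF : ∀ a, f a ∈ F := fun a => by simpa using hf a a
  -- the elements of the generated substructure which do not depend on the choice of the teeth
  set Fix : Set Gen := {x | x ∈ F ∨ (∃ z ∈ F, x = z ⊓ E) ∨ x = G} with hFix
  -- Since `E` is not below `f a`, every tooth meets `f a` where the stem does.
  have hfb : ∀ a, ∀ t ∈ T, f a ⊓ b t = f a ⊓ E := fun a t ht => by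
    refine le_antisymm (le_inf inf_le_left ?_) (inf_le_inf_left _ (hEb t ht).le)
    exact (Gen.le_total_of_le (inf_le_right : f a ⊓ b t ≤ b t) (hEb t ht).le).resolve_right
      fun h' => h.not_le _ (hfF a) (h'.trans inf_le_left)
  set z : α ⊕ β → Gen := Sum.elim f (b ∘ e) with hz
  set z' : α ⊕ β → Gen := Sum.elim f (b ∘ e') with hz'
  -- A meet is either independent of the choice of teeth or itself a tooth. The stem is never such a
  -- meet, so the signs of the teeth stay invisible.
  have hshape : ∀ p q, (z p ⊓ z q = z' p ⊓ z' q ∧ z p ⊓ z q ∈ Fix) ∨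
      ∃ x, z p ⊓ z q = b (e x) ∧ z' p ⊓ z' q = b (e' x) := by
    rintro (a | x) (a' | y) <;> simp only [hz, hz', Sum.elim_inl, Sum.elim_inr, Function.comp]
    · exact .inl ⟨trivial, .inl (hf a a')⟩
    · rw [hfb a _ (he y), hfb a _ (he' y)]
      exact .inl ⟨rfl, .inr (.inl ⟨f a, hfF a, rfl⟩)⟩
    · rw [inf_comm (b (e x)), inf_comm (b (e' x)), hfb a' _ (he x), hfb a' _ (he' x)]
      exact .inl ⟨rfl, .inr (.inl ⟨f a', hfF a', rfl⟩)⟩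
    · by_cases hxy : e x = e y
      · rw [← hxy, ← (hi x y).1 hxy, inf_idem, inf_idem]
        exact .inr ⟨x, rfl, rfl⟩
      · rw [h.inf_eq _ (he x) _ (he y) hxy, h.inf_eq _ (he' x) _ (he' y) (mt (hi x y).2 hxy)]
        exact .inl ⟨rfl, .inr (.inr rfl)⟩
  have hFixb : ∀ w ∈ Fix, ∀ t ∈ T, (w ≤ b t ↔ w ≤ E ∨ w = G) ∧ ¬ Gen.adj w (b t) := by
    rintro w (hw | ⟨y, hy, rfl⟩ | rfl) t ht
    · refine ⟨⟨fun h' => .inl ?_, ?_⟩, fun h' => (h.not_adj t ht w hw).1 (Gen.adj_symm h')⟩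
      · exact (Gen.le_total_of_le h' (hEb t ht).le).resolve_right (h.not_le w hw)
      · rintro (h' | rfl)
        exacts [h'.trans (hEb t ht).le, (h.lt_tooth t ht).le]
    · exact ⟨iff_of_true (inf_le_right.trans (hEb t ht).le) (.inl inf_le_right),
        fun h' => (h.not_adj t ht y hy).2 (Gen.adj_symm h')⟩
    · exact ⟨iff_of_true (h.lt_tooth t ht).le (.inr rfl),
        fun h' => h.not_adj_fork t ht (Gen.adj_symm h')⟩
  have hble : ∀ t ∈ T, ∀ t' ∈ T, (b t ≤ b t' ↔ t = t') := fun t ht t' ht' => by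
    refine ⟨fun h' => ?_, fun h' => h' ▸ le_rfl⟩
    by_contra hne
    have := h.inf_eq t ht t' ht' hne
    rw [inf_eq_left.2 h'] at this
    exact (h.lt_tooth t ht).ne' this
  obtain ⟨σ, hσ⟩ := Gen.exists_equiv_of_forall_iff z z' (fun p q r => by
      rcases hshape p q with ⟨h1, h2⟩ | ⟨x, h1, h2⟩
      · rw [← h1]
        rcases r with a | y
        · exact Iff.rfl
        · exact (hFixb _ h2 _ (he y)).1.trans (hFixb _ h2 _ (he' y)).1.symm
      · rw [h1, h2]
        rcases r with a | y
        · exact iff_of_false (fun h' => h.not_le _ (hfF a) ((hEb _ (he x)).le.trans h'))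
            (fun h' => h.not_le _ (hfF a) ((hEb _ (he' x)).le.trans h'))
        · exact (hble _ (he x) _ (he y)).trans ((hi x y).trans (hble _ (he' x) _ (he' y)).symm))
    (fun p q r s => by
      rcases hshape p q with ⟨h1, h2⟩ | ⟨x, h1, h2⟩ <;>
        rcases hshape r s with ⟨h3, h4⟩ | ⟨y, h3, h4⟩
      · rw [h1, h3]
      · rw [← h1, h3, h4]
        exact iff_of_false (hFixb _ h2 _ (he y)).2 (hFixb _ h2 _ (he' y)).2
      · rw [← h3, h1, h2]
        exact iff_of_false (fun h' => (hFixb _ h4 _ (he x)).2 (Gen.adj_symm h'))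
          (fun h' => (hFixb _ h4 _ (he' x)).2 (Gen.adj_symm h'))
      · rw [h1, h2, h3, h4]
        exact iff_of_false (h.not_adj_tooth _ (he x) _ (he y))
          (h.not_adj_tooth _ (he' x) _ (he' y)))
  rw [← StrongHomClass.realize_formula σ]
  apply iff_of_eq
  congr 1
  ext p
  exact hσ p

/-! ### Valuations of the constants -/

/-- Names for the elements of a transfinite family of combs indexed by `I`, with teeth of level `i`
named by `Λ i` and a sign. -/
inductive Const {I : Type u} (Λ : I → Type u) : Type u
  | stem (i : I) : Const Λ
  | fork (i : I) : Const Λ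
  | tooth (i : I) (t : Λ i) (s : Bool) : Const Λ

namespace Const

variable {I : Type u} {Λ : I → Type u}

/-- The level of a constant. -/
def level : Const Λ → I
  | stem i => i
  | fork i => i
  | tooth i _ _ => i

/-- The sign of a tooth. -/
def sign : Const Λ → Bool
  | tooth _ _ s => s
  | _ => false

/-- The teeth of a given level. -/
def teeth (Λ : I → Type u) (i : I) : Set (Const Λ) := {c | ∃ t s, c = tooth i t s}

theorem level_of_mem_teeth {i : I} {c : Const Λ} (h : c ∈ teeth Λ i) : c.level = i := by
  obtain ⟨t, s, rfl⟩ := h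
  rfl

end Const

/-- `f` depends only on finitely many arguments, all of them in `D`. -/
def SupportedOn {C : Type u} (D : Set C) (f : (C → Gen) → Gen) : Prop :=
  ∃ F : Finset C, (F : Set C) ⊆ D ∧ ∀ v w : C → Gen, (∀ c ∈ F, v c = w c) → f v = f w

theorem SupportedOn.mono {C : Type u} {D D' : Set C} {f : (C → Gen) → Gen} (h : SupportedOn D f)
    (hD : D ⊆ D') : SupportedOn D' f := by
  obtain ⟨F, hF, hf⟩ := h
  exact ⟨F, hF.trans hD, hf⟩

theorem supportedOn_eval {C : Type u} {D : Set C} {c : C} (hc : c ∈ D) :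
    SupportedOn D fun v => v c :=
  ⟨{c}, by simpa using hc, fun v w h => h c (by simp)⟩

theorem SupportedOn.comp {C : Type u} {D : Set C} {ι : Type*} [Finite ι]
    {f : ι → (C → Gen) → Gen} (hf : ∀ i, SupportedOn D (f i)) (g : (ι → Gen) → Gen) :
    SupportedOn D fun v => g fun i => f i v := by
  classical
  have := Fintype.ofFinite ι
  choose F hF h using hf
  refine ⟨Finset.univ.biUnion F, by simpa using hF, fun v w hvw => congrArg g ?_⟩
  ext i
  exact h i v w fun c hc => hvw c (Finset.mem_biUnion.2 ⟨i, Finset.mem_univ i, hc⟩)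

section Valuation

variable {I : Type u} [LinearOrder I] {Λ : I → Type u}

open ShredNTP.Const

/-- The valuation `v` makes the constants of the levels in `J` combs over the elements below, each
of which branches off at the stem from the stems of the higher levels; only the functions in `Fs`
and the teeth in `Cs` are taken into account. -/
def IsGoodValuation (Fs : Finset ((Const Λ → Gen) → Gen)) (Cs : Finset (Const Λ)) (J : Finset I)
    (v : Const Λ → Gen) : Prop :=
  ∀ i ∈ J, IsComb {z | ∃ f ∈ Fs, SupportedOn {c | c.level < i} f ∧ z = f v} (v (stem i))
      (v (fork i)) (↑Cs ∩ teeth Λ i) sign v ∧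
    ∀ j ∈ J, i < j → v (stem j) ⊓ v (fork i) = v (stem i)

theorem IsGoodValuation.mono {Fs Fs' : Finset ((Const Λ → Gen) → Gen)} {Cs Cs' : Finset (Const Λ)}
    {J J' : Finset I} {v : Const Λ → Gen} (h : IsGoodValuation Fs Cs J v) (hF : Fs' ⊆ Fs)
    (hC : Cs' ⊆ Cs) (hJ : J' ⊆ J) : IsGoodValuation Fs' Cs' J' v := fun i hi =>
  ⟨(h i (hJ hi)).1.mono (fun _ ⟨f, hf, hf'⟩ => ⟨f, hF hf, hf'⟩)
    (Set.inter_subset_inter_left _ (Finset.coe_subset.2 hC)),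
    fun j hj => (h i (hJ hi)).2 j (hJ hj)⟩

/-- Levels are added in increasing order. Only the constants of the new level are revalued, so
functions supported on lower levels keep their values and the earlier combs survive. -/
theorem exists_isGoodValuation (Fs : Finset ((Const Λ → Gen) → Gen)) (Cs : Finset (Const Λ))
    (J : Finset I) : ∃ v, IsGoodValuation Fs Cs J v := by
  classical
  induction J using Finset.induction_on_max with
  | empty => exact ⟨fun _ => default, fun i hi => absurd hi (Finset.notMem_empty i)⟩
  | insert j J hj ih =>
    obtain ⟨v, hv⟩ := ih
    -- The highest stem so far serves as `d`. Placing the new stem above it, with meets with the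
    -- earlier forks staying below `d`, makes it branch off from each of them at the earlier stem.
    obtain ⟨d, hd⟩ : ∃ d, ∀ i ∈ J, v (stem i) ≤ d ∧ d ⊓ v (fork i) = v (stem i) := by
      rcases J.eq_empty_or_nonempty with rfl | hne
      · exact ⟨default, fun i hi => absurd hi (Finset.notMem_empty i)⟩
      · refine ⟨v (stem (J.max' hne)), fun i hi => ?_⟩
        rcases (J.le_max' i hi).lt_or_eq with h | h
        · have := (hv i hi).2 _ (J.max'_mem hne) h
          exact ⟨inf_eq_right.1 (by rw [← this, ← inf_assoc, inf_idem]), this⟩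
        · rw [← h]
          exact ⟨le_rfl, inf_eq_left.2 (hv i hi).1.lt.le⟩
    obtain ⟨E, G, b, hdE, hE, hcomb⟩ := exists_isComb
      (Fs.image (fun f => f v) ∪ J.image (fun i => v (fork i))) d
      (Cs.filter (· ∈ teeth Λ j)) sign
    set w : Const Λ → Gen := fun c => if c.level = j then
      (match c with
        | stem _ => E
        | fork _ => G
        | tooth i t s => b (tooth i t s)) else v c with hw
    have hwv : ∀ c : Const Λ, c.level ≠ j → w c = v c := fun c hc => if_neg hc
    have hwE : w (stem j) = E := if_pos rfl
    have hwG : w (fork j) = G := if_pos rfl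
    have hwb : ∀ c ∈ teeth Λ j, w c = b c := by
      rintro _ ⟨t, s, rfl⟩
      exact if_pos rfl
    have hwf : ∀ i ≤ j, ∀ f, SupportedOn {c : Const Λ | c.level < i} f → f w = f v := by
      rintro i hi f ⟨F, hF, hf⟩
      exact hf w v fun c hc => hwv c (ne_of_lt (lt_of_lt_of_le (hF hc) hi))
    refine ⟨w, fun i hi => ?_⟩
    rcases Finset.mem_insert.1 hi with rfl | hiJ
    · refine ⟨?_, fun j' hj' hlt => ?_⟩
      · rw [hwE, hwG]
        refine (hcomb.mono ?_ ?_).congr fun t ht => hwb t ht.2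
        · rintro z ⟨f, hf, hfs, rfl⟩
          rw [hwf i le_rfl f hfs]
          simp only [Finset.coe_union, Finset.coe_image]
          exact .inl ⟨f, hf, rfl⟩
        · rintro t ⟨ht, ht'⟩
          simpa using ⟨ht, ht'⟩
      · rcases Finset.mem_insert.1 hj' with rfl | hj'
        · exact absurd hlt (lt_irrefl _)
        · exact absurd (hj j' hj') hlt.not_gt
    · have hij := hj i hiJ
      have hs : w (stem i) = v (stem i) := hwv _ hij.ne
      have hk : w (fork i) = v (fork i) := hwv _ hij.ne
      refine ⟨?_, fun j' hj' hlt => ?_⟩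
      · rw [hs, hk]
        refine ((hv i hiJ).1.mono ?_ subset_rfl).congr fun t ht =>
          hwv t (by rw [level_of_mem_teeth ht.2]; exact hij.ne)
        rintro z ⟨f, hf, hfs, rfl⟩
        exact ⟨f, hf, hfs, hwf i hij.le f hfs⟩
      · rw [hs, hk]
        rcases Finset.mem_insert.1 hj' with rfl | hj'
        · rw [hwE]
          obtain ⟨h1, h2⟩ := hd i hiJ
          apply le_antisymm
          · rw [← h2]
            refine le_inf ?_ inf_le_right
            rw [inf_comm]
            exact hE _ (by
              simp only [Finset.mem_union, Finset.mem_image]; exact .inr ⟨i, hiJ, rfl⟩)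
          · exact le_inf (h1.trans hdE.le) (hv i hiJ).1.lt.le
        · rw [hwv (stem j') (hj j' hj').ne]
          exact (hv i hiJ).2 j' hj' hlt

/-- There is an ultrafilter all of whose finitely many requirements on valuations are met. -/
theorem exists_ultrafilter_isGoodValuation (Λ : I → Type u) :
    ∃ W : Ultrafilter (Const Λ → Gen), ∀ Fs Cs J, ∀ᶠ v in (W : Filter (Const Λ → Gen)),
      IsGoodValuation Fs Cs J v := by
  classical
  choose v hv using fun p : Finset ((Const Λ → Gen) → Gen) × Finset (Const Λ) × Finset I =>
    exists_isGoodValuation p.1 p.2.1 p.2.2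
  refine ⟨(Ultrafilter.of Filter.atTop).map v, fun Fs Cs J => ?_⟩
  have : ∀ᶠ p in Filter.atTop, IsGoodValuation Fs Cs J (v p) := by
    filter_upwards [Filter.eventually_ge_atTop (Fs, Cs, J)] with p hp
    exact (hv p).mono hp.1 hp.2.1 hp.2.2
  exact (Ultrafilter.of_le _) this

end Valuation

/-! ### Elementary substructures, types and finite sets of parameters -/

section Generalities

variable {L : FirstOrder.Language.{0, 0}}

/-- An elementary substructure of `N` contained in another one, as an elementary substructure of
the latter. -/
def restrictElementary {N : Type u} [L.Structure N] (A B : L.ElementarySubstructure N)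
    (h : (A : Set N) ⊆ B) : L.ElementarySubstructure B where
  toSubstructure :=
    { carrier := {x | (x : N) ∈ A}
      fun_mem := fun f x hx => A.toSubstructure.fun_mem f (fun i => (x i : N)) hx }
  isElementary' := by
    apply Substructure.isElementary_of_exists
    intro n φ x a ha
    have key : ∀ (d : Empty → B) (d' : Empty → N) (y : B),
        φ.Realize d (Fin.snoc (Subtype.val ∘ x) y : Fin (n + 1) → B) ↔
        φ.Realize d' (Fin.snoc (fun i => ((x i : B) : N)) (y : N) : Fin (n + 1) → N) := by
      intro d d' y
      rw [← B.subtype.map_boundedFormula φ d (Fin.snoc (Subtype.val ∘ x) y : Fin (n + 1) → B),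
        Fin.comp_snoc, Subsingleton.elim d' (B.subtype ∘ d)]
      rfl
    set x' : Fin n → A := fun i => ⟨(x i : B), (x i).2⟩
    have h1 : (φ.ex).Realize (A.subtype ∘ default) (A.subtype ∘ x') :=
      BoundedFormula.realize_ex.2 ⟨a, (key _ _ a).1 ha⟩
    obtain ⟨y, hy⟩ := BoundedFormula.realize_ex.1 ((A.subtype.map_boundedFormula _ _ _).1 h1)
    have hy' := (A.subtype.map_boundedFormula φ _ _).2 hy
    rw [Fin.comp_snoc] at hy'
    exact ⟨⟨⟨y, h y.2⟩, y.2⟩, (key _ _ _).2 hy'⟩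

/-- A tuple in an elementary extension of `M` has a complete type over `M`. -/
theorem exists_mem_typeFormulas_iff {M N : Type u} [L.Structure M] [Nonempty M] [L.Structure N]
    (g : M ↪ₑ[L] N) {m : ℕ} (c : Fin m → N) :
    ∃ p : (L.elementaryDiagram M).CompleteType (Fin m),
      ∀ ψ, ψ ∈ typeFormulas p ↔ ψ.Realize (Sum.elim g c) := by
  let : (constantsOn M).Structure N := constantsOn.structure g
  have hcon : ∀ a : M, ((L.con a : L[[M]].Constants) : N) = g a := fun a => rfl
  have : Nonempty N := ⟨g (Classical.arbitrary M)⟩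
  have : N ⊨ L.elementaryDiagram M := by
    refine ⟨fun σ hσ => ?_⟩
    rw [← Formula.realize_equivSentence_symm_con]
    have : M ⊨ σ := hσ
    rw [← Formula.realize_equivSentence_symm_con] at this
    rw [← g.map_formula] at this
    exact this
  refine ⟨Theory.typeOf (L.elementaryDiagram M) c, fun ψ => ?_⟩
  rw [typeFormulas, Set.mem_ofPred_eq, Theory.CompleteType.formula_mem_typeOf, Formula.Realize,
    ← BoundedFormula.realize_constantsVarsEquiv, Equiv.apply_symm_apply, Formula.Realize]
  simp only [hcon]

/-- A formula with parameters uses only finitely many of them. -/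
theorem exists_finset_realize_iff {α β : Type*} (φ : L.Formula (α ⊕ β)) :
    ∃ (s : Finset α) (ψ : L.Formula (s ⊕ β)), ∀ (M : Type u) [L.Structure M] (x : α → M)
      (y : β → M), φ.Realize (Sum.elim x y) ↔ ψ.Realize (Sum.elim (fun a => x a) y) := by
  classical
  refine ⟨φ.freeVarFinset.toLeft, φ.restrictFreeVar fun w => match w with
    | ⟨.inl a, h⟩ => .inl ⟨a, Finset.mem_toLeft.2 h⟩
    | ⟨.inr b, _⟩ => .inr b, fun M _ x y => ?_⟩
  rw [Formula.Realize, Formula.Realize, BoundedFormula.realize_restrictFreeVar (Sum.elim x y)]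
  rintro ⟨a | b, h⟩ <;> rfl

end Generalities

/-! ### Ultrapowers of the generic structure -/

section Ultrapower

variable {C : Type u} (W : Ultrafilter (C → Gen))

/-- The ultrapower of the generic structure indexed by the valuations of `C`. -/
abbrev UPower : Type u := (W : Filter (C → Gen)).Product fun _ => Gen

/-- The class of a function in the ultrapower. -/
def cls (f : (C → Gen) → Gen) : UPower W := (f : (W : Filter (C → Gen)).Product fun _ => Gen)

theorem exists_cls_eq (x : UPower W) : ∃ f, cls W f = x := by
  obtain ⟨f, hf⟩ := Quotient.exists_rep x
  exact ⟨f, hf⟩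

theorem realize_cls {β : Type*} (φ : treeGraph.Formula β) (x : β → (C → Gen) → Gen) :
    φ.Realize (fun i => cls W (x i)) ↔
      ∀ᶠ v in (W : Filter (C → Gen)), φ.Realize fun i => x i v :=
  Ultraproduct.realize_formula_cast φ x

instance : UPower W ⊨ treeGraph.completeTheory Gen :=
  ⟨fun σ hσ => (Ultraproduct.sentence_realize σ).2 (.of_forall fun _ => hσ)⟩

/-- The elementary substructure of the ultrapower of the classes of the functions supported on
`D`. -/
def supported (D : Set C) : treeGraph.ElementarySubstructure (UPower W) where
  toSubstructure :=
    { carrier := {x | ∃ f, SupportedOn D f ∧ cls W f = x}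
      fun_mem := fun F x hx => by
        choose f hf hfx using hx
        refine ⟨fun v => Structure.funMap F fun i => f i v, SupportedOn.comp hf _, ?_⟩
        rw [← funext hfx]
        exact (Ultraproduct.funMap_cast F f).symm }
  isElementary' := by
    apply Substructure.isElementary_of_exists
    intro n φ x a ha
    choose f hf hfx using fun i => (x i).2
    obtain ⟨g, rfl⟩ := exists_cls_eq W a
    have key : ∀ (d : Empty → UPower W) (h : (C → Gen) → Gen),
        φ.Realize d (Fin.snoc (Subtype.val ∘ x) (cls W h) : Fin (n + 1) → UPower W) ↔
        ∀ᶠ v in (W : Filter (C → Gen)),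
          φ.Realize Empty.elim (Fin.snoc (fun i => f i v) (h v) : Fin (n + 1) → Gen) := by
      intro d h
      have h1 := Ultraproduct.boundedFormula_realize_cast (u := W) φ (fun i => i.elim)
        (Fin.snoc (α := fun _ => (C → Gen) → Gen) f h)
      have h2 : (fun i => cls W (Fin.snoc (α := fun _ => (C → Gen) → Gen) f h i)) =
          (Fin.snoc (Subtype.val ∘ x) (cls W h) : Fin (n + 1) → UPower W) := by
        change cls W ∘ (Fin.snoc (α := fun _ => (C → Gen) → Gen) f h) = _
        rw [Fin.comp_snoc]
        congr 1
        exact funext hfx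
      have h3 : ∀ v, (fun i => Fin.snoc (α := fun _ => (C → Gen) → Gen) f h i v) =
          (Fin.snoc (fun i => f i v) (h v) : Fin (n + 1) → Gen) := fun v =>
        Fin.comp_snoc (fun g : (C → Gen) → Gen => g v) f h
      rw [← h2]
      simp only [h3] at h1
      refine Iff.trans (iff_of_eq ?_) (h1.trans (iff_of_eq ?_))
      · congr 1
        exact Subsingleton.elim _ _
      · refine congrArg₂ _ (funext fun v => ?_) rfl
        congr 1
        exact Subsingleton.elim _ _
    classical
    -- A Skolem function applied pointwise to the finitely many parameters gives a witness supported
    -- on the same set `D`, which is the Tarski–Vaught criterion.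
    let c : (Fin n → Gen) → Gen := fun y =>
      Classical.epsilon fun z => φ.Realize Empty.elim (Fin.snoc y z : Fin (n + 1) → Gen)
    refine ⟨⟨_, _, SupportedOn.comp hf c, rfl⟩, (key _ _).2 ?_⟩
    filter_upwards [(key _ g).1 ha] with v hv
    exact Classical.epsilon_spec (p := fun z =>
      φ.Realize Empty.elim (Fin.snoc (fun i => f i v) z : Fin (n + 1) → Gen)) ⟨_, hv⟩

theorem supported_mono {D D' : Set C} (h : D ⊆ D') :
    (supported W D : Set (UPower W)) ⊆ supported W D' := fun _ ⟨f, hf, hfx⟩ => ⟨f, hf.mono h, hfx⟩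

end Ultrapower

/-! ### Well-orders and cardinals -/

/-- The ordinals up to `o` as a linear order in the universe of `o`. -/
theorem exists_linearOrder_rank (o : Ordinal.{u}) :
    ∃ (I : Type u) (_ : LinearOrder I) (rk : I → Ordinal.{u}),
      StrictMono rk ∧ ∀ a ≤ o, ∃ i, rk i = a := by
  -- The successor provides an index of rank `o` itself, for the stem above all levels of the chain.
  refine ⟨(Order.succ o).ToType, inferInstance, fun i => (Ordinal.ToType.mk.symm i).1,
    fun i j h => Ordinal.ToType.mk.symm.strictMono h, fun a ha => ?_⟩
  exact ⟨Ordinal.ToType.mk ⟨a, Order.lt_succ_of_le ha⟩, by simp⟩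

/-- A well-order of limit type splits into two cofinal subsets. -/
theorem exists_cofinal_sign {o : Ordinal.{u}} (ho : Order.IsSuccLimit o) :
    ∃ s : o.ToType → Bool, ∀ α r, ∃ β, α ≤ β ∧ s β = r := by
  classical
  -- The sign is the parity of the ordinal, which changes from `α` to its successor.
  refine ⟨fun α => decide ((Ordinal.ToType.mk.symm α).1 % 2 = 0), fun α r => ?_⟩
  set a := (Ordinal.ToType.mk.symm α).1 with ha
  have hao : a < o := (Ordinal.ToType.mk.symm α).2
  set β : o.ToType := Ordinal.ToType.mk ⟨a + 1, ho.add_one_lt hao⟩ with hβ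
  have hαβ : α ≤ β := by
    rw [hβ, ← Ordinal.ToType.mk.symm_apply_le, ← Subtype.coe_le_coe]
    exact le_self_add
  have hβ1 : (Ordinal.ToType.mk.symm β).1 = a + 1 := by simp [hβ]
  have h2 : a % 2 = 0 ∨ a % 2 = 1 := by
    have := Ordinal.mod_lt a (b := 2) two_ne_zero
    rw [← one_add_one_eq_two, Order.lt_add_one_iff] at this
    rcases this.lt_or_eq with h | h
    · rw [one_add_one_eq_two] at h; exact .inl (Order.lt_one_iff.1 h)
    · right; rw [one_add_one_eq_two] at h; exact h
  have h3 : a % 2 = 0 ↔ ¬ (a + 1) % 2 = 0 := by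
    rw [← Ordinal.div_add_mod a 2, add_assoc, Ordinal.mul_add_mod_self, Ordinal.mul_add_mod_self]
    rcases h2 with h | h <;> rw [h]
    · simp [Ordinal.mod_eq_of_lt]
    · rw [one_add_one_eq_two]; simp [Ordinal.mod_eq_of_lt]
  by_cases hr : decide (a % 2 = 0) = r
  · exact ⟨α, le_rfl, hr⟩
  · refine ⟨β, hαβ, ?_⟩
    change decide ((Ordinal.ToType.mk.symm β).1 % 2 = 0) = r
    rw [hβ1]
    revert hr
    cases r <;> simp [h3]

/-- There are at most `ℶ_ (o + 1)` functions supported on a set of that size. -/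
theorem mk_supportedOn_le {C : Type u} (D : Set C) {o : Ordinal.{u}} (hD : #D ≤ ℶ_ (Order.succ o)) :
    #{f // SupportedOn D f} ≤ ℶ_ (Order.succ o) := by
  classical
  set μ := ℶ_ (Order.succ o) with hμ
  have hμ0 : ℵ₀ ≤ μ := aleph0_le_beth _
  -- The index is a successor so that `μ` is at least `ℶ_ 1 = 𝔠`, the bound for functions of
  -- finitely many arguments from the countable set `Gen`.
  have hμc : 𝔠 ≤ μ := by
    rw [← beth_one, hμ, beth_le_beth]
    simp
  set g : (Σ F : Finset D, (F → Gen) → Gen) → ((C → Gen) → Gen) :=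
    fun p v => p.2 fun c => v c.1.1 with hg
  have h1 : {f | SupportedOn D f} ⊆ Set.range g := by
    rintro f ⟨F, hF, hf⟩
    refine ⟨⟨F.subtype (· ∈ D), fun u => f fun c =>
      if h : ∃ hc : c ∈ D, (⟨c, hc⟩ : D) ∈ F.subtype (· ∈ D) then u ⟨⟨c, h.1⟩, h.2⟩ else default⟩,
      ?_⟩
    ext v
    refine hf _ _ fun c hc => ?_
    have h : ∃ hc : c ∈ D, (⟨c, hc⟩ : D) ∈ F.subtype (· ∈ D) := ⟨hF hc, by simpa using hc⟩
    exact dif_pos h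
  have h2 : #(Finset D) ≤ μ := by
    obtain ⟨e⟩ : Nonempty (D ↪ μ.out) := by rw [← Cardinal.le_def, mk_out]; exact hD
    have : Infinite μ.out := by rw [Cardinal.infinite_iff, mk_out]; exact hμ0
    calc #(Finset D) ≤ #(Finset μ.out) :=
          mk_le_of_injective (f := Finset.map e) (Finset.map_injective e)
      _ = μ := by rw [mk_finset_of_infinite, mk_out]
  have h3 : ∀ F : Finset D, #((F → Gen) → Gen) ≤ 𝔠 := by
    intro F
    rw [mk_arrow, ← aleph0_power_aleph0]
    refine (power_le_power_right ?_).trans (power_le_power_left aleph0_ne_zero ?_) <;>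
    rw [lift_le_aleph0] <;> exact mk_le_aleph0
  calc #{f // SupportedOn D f} ≤ #(Set.range g) := mk_le_mk_of_subset h1
    _ ≤ #(Σ F : Finset D, (F → Gen) → Gen) := mk_range_le
    _ ≤ μ := by
      rw [mk_sigma]
      refine (sum_le_sum _ (fun _ => μ) fun F => (h3 F).trans hμc).trans ?_
      rw [sum_const']
      exact (mul_le_mul_left h2 μ).trans (mul_eq_self hμ0).le

/-- If the teeth of level `i` are named by a set of size `ℶ_ (rk i + 2)`, there are at most
`ℶ_ (o + 1)` constants of rank below `o`. -/
theorem mk_setOf_level_lt_le {I : Type u} {rk : I → Ordinal.{u}} (hrk : Function.Injective rk)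
    (o : Ordinal.{u}) :
    #{c : Const (fun i => (ℶ_ (Order.succ (Order.succ (rk i)))).out) | rk c.level < o} ≤
      ℶ_ (Order.succ o) := by
  set Λ : I → Type u := fun i => (ℶ_ (Order.succ (Order.succ (rk i)))).out with hΛ
  set μ := ℶ_ (Order.succ o) with hμ
  have hμ0 : ℵ₀ ≤ μ := aleph0_le_beth _
  have hI : #{i // rk i < o} ≤ μ := by
    refine le_trans (mk_le_of_injective (β := o.ToType)
      (f := fun i => Ordinal.ToType.mk ⟨rk i.1, i.2⟩) fun i j h => ?_) ?_
    · have := Ordinal.ToType.mk.injective h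
      exact Subtype.ext (hrk (congrArg Subtype.val this))
    · rw [mk_toType]
      exact o.card_le_beth.trans (beth_le_beth.2 (Order.le_succ o))
  have hΛμ : ∀ i, rk i < o → #(Λ i) ≤ μ := fun i hi => by
    rw [hΛ, mk_out]
    exact beth_le_beth.2 (Order.succ_le_succ (Order.succ_le_of_lt hi))
  have hle : #{c : Const Λ | rk c.level < o} ≤
      #(Σ i : {i // rk i < o}, (ULift.{u} Bool ⊕ Λ i × ULift.{u} Bool)) := by
    refine mk_le_of_injective (f := fun c => match c with
      | ⟨.stem i, h⟩ => ⟨⟨i, h⟩, .inl ⟨true⟩⟩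
      | ⟨.fork i, h⟩ => ⟨⟨i, h⟩, .inl ⟨false⟩⟩
      | ⟨.tooth i t s, h⟩ => ⟨⟨i, h⟩, .inr (t, ⟨s⟩)⟩) ?_
    rintro ⟨_ | _ | _, _⟩ ⟨_ | _ | _, _⟩ h <;>
      obtain ⟨h1, h2⟩ := Sigma.mk.inj h <;> cases Subtype.mk.inj h1 <;> simp_all
  refine hle.trans ?_
  rw [mk_sigma]
  refine (sum_le_sum _ (fun _ => μ) fun i => ?_).trans ?_
  · have h2 : (2 : Cardinal) ≤ μ := (natCast_lt_aleph0 (n := 2)).le.trans hμ0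
    simp only [mk_sum, mk_prod, lift_id, mk_uLift, mk_bool, lift_ofNat]
    exact (add_le_add h2 ((mul_le_mul' (hΛμ i i.2) h2).trans (mul_eq_self hμ0).le)).trans
      (add_eq_self hμ0).le
  · rw [sum_const']
    exact (mul_le_mul' hI le_rfl).trans (mul_eq_self hμ0).le

/-! ### Shredding -/

section Combs

open ShredNTP.Const

variable {I : Type u} [LinearOrder I] {Λ : I → Type u} {W : Ultrafilter (Const Λ → Gen)}

/-- The teeth of level `i` are indiscernible over the elements supported on the lower levels. -/
theorem realize_iff_of_mem_teeth
    (hW : ∀ Fs Cs J, ∀ᶠ v in (W : Filter (Const Λ → Gen)), IsGoodValuation Fs Cs J v)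
    {α β : Type*} [Finite β] (i : I) (x : α → UPower W)
    (hx : ∀ a, x a ∈ supported W {c | c.level < i}) {e e' : β → Const Λ} (he : ∀ q, e q ∈ teeth Λ i)
    (he' : ∀ q, e' q ∈ teeth Λ i) (hi : ∀ q r, e q = e r ↔ e' q = e' r)
    (φ : treeGraph.Formula (α ⊕ β)) :
    φ.Realize (Sum.elim x fun q => cls W fun v => v (e q)) ↔
      φ.Realize (Sum.elim x fun q => cls W fun v => v (e' q)) := by
  classical
  have := Fintype.ofFinite β
  obtain ⟨s, ψ, hψ⟩ := exists_finset_realize_iff φ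
  rw [hψ, hψ]
  choose f hf hfx using fun a : s => hx a
  have key : ∀ e : β → Const Λ,
      (Sum.elim (fun a : s => x a) fun q => cls W fun v => v (e q)) =
        fun p => cls W (Sum.elim f (fun q v => v (e q)) p) := by
    intro e
    ext (a | q)
    · exact (hfx a).symm
    · rfl
  rw [key, key, realize_cls, realize_cls]
  apply Filter.eventually_congr
  -- The comb must lie over the binary meets of the parameters as well, and these are again
  -- supported on the lower levels.
  filter_upwards [hW (Finset.univ.image fun p : s × s => fun v => f p.1 v ⊓ f p.2 v)
    (Finset.univ.image e ∪ Finset.univ.image e') {i}] with v hv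
  have h := (hv i (Finset.mem_singleton_self i)).1
  have := h.realize_iff (fun a => f a v) (fun a a' => ⟨_, Finset.mem_image_of_mem
      (fun p : s × s => fun v => f p.1 v ⊓ f p.2 v) (Finset.mem_univ (a, a')), ?_, rfl⟩)
    (e := e) (e' := e') (fun q => ⟨by simp, he q⟩) (fun q => ⟨by simp, he' q⟩) hi ψ
  · have key' : ∀ e : β → Const Λ, (fun p => Sum.elim f (fun q v => v (e q)) p v) =
        Sum.elim (fun a => f a v) (v ∘ e) := by
      intro e
      ext (a | q) <;> rfl
    rw [key', key']
    exact this
  · exact SupportedOn.comp (ι := Bool) (f := fun b => bif b then f a else f a')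
      (by rintro (_ | _); exacts [hf a', hf a]) fun y => y true ⊓ y false

theorem tmeet_stem_fork
    (hW : ∀ Fs Cs J, ∀ᶠ v in (W : Filter (Const Λ → Gen)), IsGoodValuation Fs Cs J v) {i j : I}
    (hij : i < j) : tmeet (cls W fun v => v (stem j)) (cls W fun v => v (fork i)) =
      cls W fun v => v (stem i) := by
  have h := (realize_cls W ((meetTerm (Term.var 0) (Term.var 1)).equal (Term.var 2) :
    treeGraph.Formula (Fin 3)) ![fun v => v (stem j), fun v => v (fork i), fun v => v (stem i)]).2
  simp only [Formula.realize_equal, realize_meetTerm, Term.realize_var] at h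
  apply h
  filter_upwards [hW ∅ ∅ {i, j}] with v hv
  exact (hv i (by simp)).2 j (by simp) hij

theorem stem_lt_fork_lt_tooth
    (hW : ∀ Fs Cs J, ∀ᶠ v in (W : Filter (Const Λ → Gen)), IsGoodValuation Fs Cs J v) {i : I}
    {c : Const Λ} (hc : c ∈ teeth Λ i) :
    (cls W fun v => v (stem i)) ≠ (cls W fun v => v (fork i)) ∧
    tle (cls W fun v => v (fork i)) (cls W fun v => v c) ∧
    (tadj (cls W fun v => v (stem i)) (cls W fun v => v c) ↔ c.sign = true) := by
  have hc' : c ∈ (({c} : Finset (Const Λ)) : Set (Const Λ)) ∩ teeth Λ i := ⟨by simp, hc⟩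
  have h1 := realize_cls W (((Term.var 0).equal (Term.var 1) : treeGraph.Formula (Fin 2)).not)
    ![fun v => v (stem i), fun v => v (fork i)]
  have h2 := realize_cls W (leFormula (Term.var 0) (Term.var 1) : treeGraph.Formula (Fin 2))
    ![fun v => v (fork i), fun v => v c]
  have h3 := realize_cls W (adjFormula (Term.var 0) (Term.var 1) : treeGraph.Formula (Fin 2))
    ![fun v => v (stem i), fun v => v c]
  simp only [Formula.realize_not, Formula.realize_equal, realize_leFormula, realize_adjFormula,
    Term.realize_var] at h1 h2 h3
  refine ⟨h1.2 ?_, h2.2 ?_, h3.trans ?_⟩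
  · filter_upwards [hW ∅ {c} {i}] with v hv
    exact (hv i (by simp)).1.lt.ne
  · filter_upwards [hW ∅ {c} {i}] with v hv
    exact ((hv i (by simp)).1.lt_tooth c hc').le
  · have h4 : ∀ᶠ v in (W : Filter (Const Λ → Gen)),
        (tadj (v (stem i)) (v c) ↔ c.sign = true) := by
      filter_upwards [hW ∅ {c} {i}] with v hv
      rw [← (hv i (by simp)).1.adj_stem c hc']
      exact ⟨Gen.adj_symm, Gen.adj_symm⟩
    exact (Filter.eventually_congr h4).trans Filter.eventually_const

end Combs

/-- In a model of the theory of the generic structure, an element branching off at `e` from `g > e`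
branches off at `e` from every element above `g`. -/
theorem tmeet_eq_of_tle {N : Type u} [treeGraph.Structure N] [N ⊨ treeGraph.completeTheory Gen]
    {x g e b : N} (h1 : tmeet x g = e) (h2 : e ≠ g) (h3 : tle g b) : tmeet x b = e := by
  obtain ⟨a, ha⟩ := exists_realize_iff (A := Gen) (W := Fin 4) (κ := Fin 4)
    ![(meetTerm (Term.var 0) (Term.var 1)).equal (Term.var 2), (Term.var 2).equal (Term.var 1),
      leFormula (Term.var 1) (Term.var 3), (meetTerm (Term.var 0) (Term.var 3)).equal (Term.var 2)]
    ![x, g, e, b]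
  have k0 := ha 0
  have k1 := ha 1
  have k2 := ha 2
  have k3 := ha 3
  simp [Formula.realize_equal, realize_meetTerm, realize_leFormula, Gen.tmeet_eq,
    Gen.tle_iff] at k0 k1 k2 k3
  rw [k3]
  rw [k0] at h1
  rw [Ne, k1] at h2
  rw [k2] at h3
  refine le_antisymm ?_ (h1 ▸ inf_le_inf_left _ h3)
  -- The meet with `b` and the fork `g` both lie below `b`. If `g` were the lower one, `x` would lie
  -- above `g`, forcing `e = g`.
  rcases Gen.le_total_of_le (inf_le_right : a 0 ⊓ a 3 ≤ a 3) h3 with h | h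
  · rw [← h1]; exact le_inf inf_le_left h
  · exact absurd (h1.symm.trans (inf_eq_right.2 (h.trans inf_le_left))) h2

theorem aleph0_le_shredLength {L : FirstOrder.Language.{0, 0}} {M : Type u} (A : Set M) :
    ℵ₀ ≤ shredLength L A :=
  (le_add_left le_rfl).trans (le_self_add.trans (Order.le_succ _))

/-- The language is countable, so by Cantor's theorem one more power set exceeds `|T| + |A|`. This
is why level `i` receives `ℶ_ (rk i + 2)` teeth. -/
theorem shredLength_treeGraph_le {M : Type u} {A : Set M} {o : Ordinal.{u}}
    (h : #A ≤ ℶ_ (Order.succ o)) :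
    shredLength treeGraph A ≤ ℶ_ (Order.succ (Order.succ o)) := by
  rw [beth_succ (Order.succ o)]
  refine Order.succ_le_of_lt (lt_of_le_of_lt ?_ (cantor _))
  have hμ0 : ℵ₀ ≤ ℶ_ (Order.succ o) := aleph0_le_beth _
  have hL : lift.{u} treeGraph.card ≤ ℵ₀ := by
    have : Countable (Σ l, treeGraph.Relations l) := by
      have : Finite (Σ l, TreeGraphRelations l) := Finite.of_surjective
        (fun r : Bool => (⟨2, bif r then .le else .adj⟩ : Σ l, TreeGraphRelations l)) (by
          rintro ⟨_, _ | _⟩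
          exacts [⟨true, rfl⟩, ⟨false, rfl⟩])
      exact (inferInstance : Countable (Σ l, TreeGraphRelations l))
    rw [lift_le_aleph0, card]
    exact mk_le_aleph0
  exact add_le_of_le hμ0 (add_le_of_le hμ0 (hL.trans hμ0) hμ0) h

theorem relabel_equal {L : FirstOrder.Language.{0, 0}} {α β : Type*} (g : α → β)
    (t t' : L.Term α) :
    Formula.relabel g (t.equal t') = (t.relabel g).equal (t'.relabel g) := by
  have h : ∀ s : L.Term α, (s.relabel Sum.inl).relabel (BoundedFormula.relabelAux
      (n := 0) (Sum.inl ∘ g) 0) = (s.relabel g).relabel Sum.inl := fun s => by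
    rw [Term.relabel_relabel, Term.relabel_relabel]
    rfl
  rw [Term.equal, Term.equal, ← h, ← h]
  rfl

theorem relabel_meetTerm {α β : Type*} (g : α → β) (t t' : treeGraph.Term α) :
    (meetTerm t t').relabel g = meetTerm (t.relabel g) (t'.relabel g) := by
  rw [meetTerm, meetTerm]
  refine congrArg (Term.func (L := treeGraph) (l := 2) TreeGraphFunctions.meet) (funext fun i => ?_)
  fin_cases i <;> rfl

/-- The type of a stem above level `i` shreds over the levels below `i`. -/
theorem restrictionShreds_of_level {I : Type u} [LinearOrder I] {Λ : I → Type u}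
    {W : Ultrafilter (Const Λ → Gen)}
    (hW : ∀ Fs Cs J, ∀ᶠ v in (W : Filter (Const Λ → Gen)), IsGoodValuation Fs Cs J v)
    {B : treeGraph.ElementarySubstructure (UPower W)} {A A' : Set B} {i top : I} (hi : i < top)
    (hAA' : A ⊆ A') (hA : ∀ x ∈ A, (x : UPower W) ∈ supported W {c | c.level < i})
    (hlev : ∀ c : Const Λ, c.level = i → (cls W fun v => v c) ∈ B)
    (hlev' : ∀ (c : Const Λ) (hc : c.level = i), (⟨_, hlev c hc⟩ : B) ∈ A')
    (hcard : shredLength treeGraph A ≤ #(Λ i))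
    {p : (treeGraph.elementaryDiagram B).CompleteType (Fin 1)}
    (hp : ∀ ψ, ψ ∈ typeFormulas p ↔
      ψ.Realize (Sum.elim B.subtype fun _ => cls W fun v => v (Const.stem top))) :
    RestrictionShreds p A A' := by
  obtain ⟨g⟩ : Nonempty ((shredLength treeGraph A).ord.ToType ↪ Λ i) := by
    rw [← Cardinal.le_def, mk_toType, card_ord]
    exact hcard
  obtain ⟨sgn, hsgn⟩ := exists_cofinal_sign (isSuccLimit_ord (aleph0_le_shredLength A))
  set t : (shredLength treeGraph A).ord.ToType → Const Λ := fun α =>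
    Const.tooth i (g α) (sgn α) with ht
  have htinj : Function.Injective t := fun α β h =>
    g.injective (eq_of_heq (Const.tooth.inj h).2.1)
  have htt : ∀ α, t α ∈ Const.teeth Λ i := fun α => ⟨_, _, rfl⟩
  set E : B := ⟨_, hlev (Const.stem i) rfl⟩ with hE
  set G : B := ⟨_, hlev (Const.fork i) rfl⟩ with hG
  set b : (shredLength treeGraph A).ord.ToType → Fin 1 → B := fun α _ => ⟨_, hlev (t α) rfl⟩
    with hb
  -- The shredding formula is `x ∧ G = E`. It holds of every stem of a higher level, and its two
  -- parameters lie in `A'` though they belong to level `i`.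
  refine ⟨hAA',
    (meetTerm (Term.var (Sum.inr 0)) (Term.var (Sum.inl G))).equal (Term.var (Sum.inl E)), ?_,
    1, b, fun α _ => hlev' _ rfl, ?_, ?_⟩
  · intro N _ f c h
    refine h _ ⟨(hp _).2 ?_,
      (meetTerm (Term.var (Sum.inr 0)) (Term.var (Sum.inl ⟨G, hlev' _ rfl⟩))).equal
        (Term.var (Sum.inl ⟨E, hlev' _ rfl⟩)), ?_⟩
    · rw [Formula.realize_equal, realize_meetTerm]
      exact tmeet_stem_fork hW hi
    · rw [relabel_equal, relabel_meetTerm]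
      rfl
  · intro n φ s s' hs hs'
    have h := realize_iff_of_mem_teeth hW i (fun a : A => ((a : B) : UPower W))
      (fun a => hA a a.2) (e := fun q : Fin n × Fin 1 => t (s q.1))
      (e' := fun q : Fin n × Fin 1 => t (s' q.1)) (fun q => htt _) (fun q => htt _)
      (fun q r => by rw [htinj.eq_iff, htinj.eq_iff, hs.injective.eq_iff, hs'.injective.eq_iff]) φ
    rw [← B.subtype.map_formula, ← B.subtype.map_formula]
    convert h using 2 <;>
    · ext (a | q) <;> rfl
  · intro N _ f c hφ α hind
    have : N ⊨ treeGraph.completeTheory Gen :=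
      (f.theory_model_iff _).1 inferInstance
    rw [Formula.realize_equal, realize_meetTerm] at hφ
    have hmeet : ∀ β, tmeet (c 0) (f (b β 0)) = f E := fun β => by
      obtain ⟨h1, h2, -⟩ := stem_lt_fork_lt_tooth hW (htt β)
      refine tmeet_eq_of_tle hφ (fun h => h1 (congrArg Subtype.val (f.injective h))) ?_
      exact (tle_map f.toEmbedding _ _).2 ((tle_map B.subtype.toEmbedding _ _).1 h2)
    have hadj : ∀ β, tadj (f E) (f (b β 0)) ↔ sgn β = true := fun β => by
      obtain ⟨-, -, h3⟩ := stem_lt_fork_lt_tooth hW (htt β)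
      exact (tadj_map f.toEmbedding _ _).trans ((tadj_map B.subtype.toEmbedding _ _).symm.trans h3)
    -- For any realization, `x ∧ b = E` on all teeth, so `R(x ∧ b, b)` holds exactly at the positive
    -- ones; both signs occur beyond `α`.
    obtain ⟨β, hβ, hβs⟩ := hsgn α true
    obtain ⟨γ, hγ, hγs⟩ := hsgn α false
    have := hind 1 (adjFormula (meetTerm (Term.var (Sum.inl ⟨c 0, .inr ⟨0, rfl⟩⟩))
      (Term.var (Sum.inr (0, 0)))) (Term.var (Sum.inr (0, 0)))) (fun _ => ⟨β, hβ⟩)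
      (fun _ => ⟨γ, hγ⟩) (Subsingleton.strictMono _) (Subsingleton.strictMono _)
    rw [realize_adjFormula, realize_adjFormula, realize_meetTerm, realize_meetTerm] at this
    simp only [Term.realize_var, Sum.elim_inl, Sum.elim_inr, hmeet, hadj, hβs, hγs] at this
    simp at this

/-- There are shredding chains of every length in one variable. -/
theorem hasShredChain (κ : Cardinal.{u}) :
    HasShredChain (treeGraph.completeTheory Gen) 1 κ := by
  classical
  obtain ⟨I, _, rk, hrk, hsurj⟩ := exists_linearOrder_rank κ.ord
  set Λ : I → Type u := fun i => (ℶ_ (Order.succ (Order.succ (rk i)))).out with hΛ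
  obtain ⟨W, hW⟩ := exists_ultrafilter_isGoodValuation Λ
  -- Truncating at `κ.ord` keeps every `D o` inside `D κ.ord`, so the chain can be indexed by all
  -- ordinals.
  set D : Ordinal.{u} → Set (Const Λ) := fun o => {c | rk c.level < min o κ.ord} with hD
  have hDmono : Monotone D := fun o o' h c hc => lt_of_lt_of_le hc (min_le_min_right _ h)
  have hDκ : ∀ o, D o ⊆ D κ.ord := fun o c hc => by
    simp only [hD, min_self, Set.mem_ofPred_eq] at hc ⊢
    exact lt_of_lt_of_le hc (min_le_right _ _)
  set B := supported W (D κ.ord) with hB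
  set S : Ordinal.{u} → treeGraph.ElementarySubstructure B := fun o =>
    restrictElementary (supported W (D o)) B (supported_mono W (hDκ o)) with hS
  have hconst : ∀ c : Const Λ, ∀ o, rk c.level < o → o ≤ κ.ord →
      (cls W fun v => v c) ∈ supported W (D o) := fun c o h h' =>
    ⟨_, supportedOn_eval (by simpa [hD] using ⟨h, h.trans_le h'⟩), rfl⟩
  obtain ⟨top, htop⟩ := hsurj κ.ord le_rfl
  -- The type is that of a stem of rank `κ.ord`, above all levels used in the models.
  obtain ⟨p, hp⟩ := exists_mem_typeFormulas_iff B.subtype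
    (fun _ : Fin 1 => cls W fun v => v (Const.stem top))
  refine ⟨Theory.ModelType.of (treeGraph.completeTheory Gen) B, S, p, ?_, ?_, ?_, ?_⟩
  · intro i j hij _ x
    exact fun ⟨f, hf, hfx⟩ => ⟨f, hf.mono (hDmono hij), hfx⟩
  · intro δ hδκ hδ
    ext x
    simp only [Set.mem_iUnion]
    constructor
    · rintro ⟨f, ⟨F, hF, hf⟩, hfx⟩
      -- Continuity at limits: a finite support has bounded rank below `δ`.
      obtain ⟨o, ho, hFo⟩ : ∃ o < δ, ∀ c ∈ F, rk c.level < o := by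
        have h : ∀ c ∈ F, rk c.level < δ := fun c hc => (hF hc).trans_le (min_le_left _ _)
        refine ⟨F.sup fun c => Order.succ (rk c.level), ?_, fun c hc => ?_⟩
        · exact (Finset.sup_lt_iff hδ.bot_lt).2 fun c hc => hδ.succ_lt (h c hc)
        · exact (Order.lt_succ _).trans_le (Finset.le_sup (f := fun c => Order.succ (rk c.level)) hc)
      exact ⟨o, ho, f, ⟨F, fun c hc => lt_min (hFo c hc) ((hFo c hc).trans_le
        (ho.le.trans hδκ)), hf⟩, hfx⟩
    · rintro ⟨o, ho, f, hf, hfx⟩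
      exact ⟨f, hf.mono (hDmono (le_of_lt ho)), hfx⟩
  · ext x
    exact iff_of_true x.2 trivial
  · intro o ho
    obtain ⟨i, rfl⟩ := hsurj o ho.le
    have hsucc : Order.succ (rk i) ≤ κ.ord := Order.succ_le_of_lt ho
    have hiκ : i < top := hrk.lt_iff_lt.1 (by rw [htop]; exact ho)
    have hD' : D (rk i) = {c | c.level < i} := by
      ext c
      simp only [hD, min_eq_left ho.le, Set.mem_ofPred_eq, hrk.lt_iff_lt]
    refine restrictionShreds_of_level hW hiκ
      (A := (S (rk i) : Set B)) (A' := (S (Order.succ (rk i)) : Set B))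
      (fun x ⟨f, hf, hfx⟩ => ⟨f, hf.mono (hDmono (Order.le_succ _)), hfx⟩)
      (fun x hx => by rw [← hD']; exact hx)
      (fun c hc => hconst c _ (by rw [hc]; exact ho) le_rfl)
      (fun c hc => hconst c _ (by rw [hc]; exact Order.lt_succ _) hsucc) ?_ hp
    rw [mk_out]
    refine shredLength_treeGraph_le ?_
    refine le_trans (mk_le_of_surjective (α := {f // SupportedOn (D (rk i)) f})
      (f := fun f => ⟨⟨cls W f.1, supported_mono W (hDκ _) ⟨f.1, f.2, rfl⟩⟩, ⟨f.1, f.2, rfl⟩⟩) ?_)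
      (mk_supportedOn_le _ ?_)
    · rintro ⟨⟨x, hx⟩, f, hf, hfx⟩
      exact ⟨⟨f, hf⟩, Subtype.ext (Subtype.ext hfx)⟩
    · simp only [hD, min_eq_left ho.le]
      exact mk_setOf_level_lt_le hrk.injective _

/-- Chains of every length exist already in one variable, so the infimum defining `kappaShredIn` at
`1` runs over the empty set. -/
theorem kappaShred_gen : kappaShred.{u} (treeGraph.completeTheory Gen) = ⊤ := by
  have h : kappaShredIn.{u} (treeGraph.completeTheory Gen) 1 = ⊤ := by
    rw [kappaShredIn]
    have : {κ : Cardinal.{u} | κ.IsRegular ∧ ¬ HasShredChain (treeGraph.completeTheory Gen) 1 κ} =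
        ∅ := by
      ext κ
      exact iff_of_false (fun h => h.2 (hasShredChain κ)) (by simp)
    rw [this, Set.image_empty, WithTop.sInf_empty]
  exact WithTop.sSup_of_top_mem ⟨1, h⟩

end ShredNTP

end

theorem mainTheorem9 :
    (∃ (M : Type) (_ : ShredNTP.treeGraph.Structure M) (_ : Countable M),
      FirstOrder.Language.IsFraisseLimit ShredNTP.finiteTreeGraphs M) ∧
    (∀ (M : Type) [ShredNTP.treeGraph.Structure M] [Countable M],
      FirstOrder.Language.IsFraisseLimit ShredNTP.finiteTreeGraphs M →
        ShredNTP.IsNTP2.{u} (ShredNTP.treeGraph.completeTheory M) ∧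
        ShredNTP.IsInpMinimal.{u} (ShredNTP.treeGraph.completeTheory M) ∧
        ShredNTP.kappaShred.{u} (ShredNTP.treeGraph.completeTheory M) = ⊤) ∧
    ¬ (∀ (L : FirstOrder.Language.{0, 0}) (T : L.Theory), T.IsComplete →
        ShredNTP.IsNTP2.{u} T → ShredNTP.IsUnshreddable.{u} T) := by
  refine ⟨⟨ShredNTP.Gen, inferInstance, inferInstance, ShredNTP.Gen.isFraisseLimit⟩, ?_, ?_⟩
  · intro M _ _ hM
    -- Uniqueness of the countable Fraïssé limit reduces every case to the concrete model.
    obtain ⟨e⟩ := FirstOrder.Language.IsFraisseLimit.nonempty_equiv hM ShredNTP.Gen.isFraisseLimit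
    have h : ShredNTP.treeGraph.completeTheory M =
        ShredNTP.treeGraph.completeTheory ShredNTP.Gen := e.toElementaryEmbedding.elementarilyEquivalent
    rw [h]
    exact ⟨ShredNTP.isNTP2_gen, ShredNTP.isInpMinimal_gen, ShredNTP.kappaShred_gen⟩
  · intro h
    exact (h ShredNTP.treeGraph (ShredNTP.treeGraph.completeTheory ShredNTP.Gen)
      (FirstOrder.Language.completeTheory.isComplete _ _) ShredNTP.isNTP2_gen).ne
      ShredNTP.kappaShred_gen
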